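/- Let $p$ be an odd prime and let $\mathbb{C}_p$ be the completion of an algebraic closure of $\mathbb{Q}_p$; all characters below take values in $\mathbb{C}_p$. Notation. Let $\omega$ be the Teichmüller character: for an integer $a$ prime to $p$, $\omega(a)\in\mathbb{Z}_p$ is the $(p-1)$-st root of unity with $\omega(a)\equiv a \pmod p$; put $\langle a\rangle=\omega(a)^{-1}a$ and, for $t\in\mathbb{Z}_p$, $\langle a\rangle^{t}=\sum_{n\ge 0}\binom{t}{n}(\langle a\rangle-1)^n$. For $x\in 1+p\mathbb{Z}_p$ let $\log_p x=\sum_{n\ge1}(-1)^{n+1}(x-1)^n/n$. Let $B_n$ be the Bernoulli numbers, $\sum_{n\ge 0} B_nz^n/n!=z/(e^z-1)$. For a primitive Dirichlet character $\chi$ modulo $f$ and $s\in\mathbb{Z}_p$, $s\neq1$, put, with $D=pf$ (a common multiple of $p$ and $f$), $$L_p(s,\chi)=\frac1D\,\frac1{s-1}\sum_{\substack{1\le a\le D\\ (a,p)=1}}\chi(a)\langle a\rangle^{1-s}\sum_{n=0}^{\infty}\binom{1-s}{n}B_n\Big(\frac Da\Big)^n,$$ and, for $\chi$ nontrivial, let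 $L_p(1,\chi)=\lim_{s\to1,\,s\ne1}L_p(s,\chi)$. For a primitive character $\psi$ and an integer $k$, $\psi\omega^{k}$ denotes the primitive character that induces the product. Write $f_\psi$ for the conductor of $\psi$, $\overline\psi=\psi^{-1}$, $\mathbf 1$ for the trivial character of conductor $1$, $\varphi$ for Euler's function, and, for $f_\psi\mid r$, $$d(\psi,r,n)=\prod_{\substack{q\mid r/f_\psi\\ q\ \mathrm{prime}}}\bigl(1-\psi(q)q^{n}\bigr)\qquad(n\in\mathbb{Z}).$$ Theorem. Let $d,r,m$ be positive integers with $(r,dp)=1$; below, $\psi$ runs over the primitive Dirichlet characters with $f_\psi\mid r$. For each $\psi$ the series in $n$ below converges in $\mathbb{C}_p$, and the following identities hold in $\mathbb{C}_p$. (i) When $m=1$, $$\sum_{\substack{1\le k\le[dp/r]\\ (k,p)=1}}\frac1k=-\frac1p\Bigl(\log_p r^{p-1}+\sum_{\substack{q\mid r\\ q\ \mathrm{prime}}}\frac{\log_p q^{p-1}}{q-1}\Bigr)-\frac{r}{\varphi(r)}\sum_{n=0}^{\infty}\ \sum_{\substack{f_\psi\mid r\\ (\psi,n)\ne(\mathbf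 1,0)}}\overline\psi(-dp)(-1)^n d(\psi,r,-1-n)\,L_p(1+n,\psi\omega^{-n})(dp)^n .$$ (ii) When $m>1$, $$\sum_{\substack{1\le k\le[dp/r]\\ (k,p)=1}}\frac1{k^m}=L_p(m,\omega^{1-m})-\frac{r^m}{\varphi(r)}\sum_{f_\psi\mid r}\overline\psi(-dp)\sum_{n=0}^{\infty}\binom{-m}{n}d(\psi,r,-m-n)\,L_p(m+n,\psi\omega^{1-m-n})(dp)^n .$$ -/

import Mathlib

open scoped Topology

noncomputable section

namespace Lehmer

/-- The Teichmüller lift `ZMod p → ℤ_[p]`: a residue class `a ≠ 0` goes to the `(p-1)`-st root of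
unity in `ℤ_[p]` congruent to `a` modulo `p`, and `0` goes to `0`
(see `teich_pow` and `toZMod_teich`). -/
def teich (p : ℕ) [Fact p.Prime] (a : ZMod p) : ℤ_[p] :=
  WittVector.equiv p (WittVector.teichmuller p a)

theorem teich_pow (p : ℕ) [Fact p.Prime] (a : ZMod p) (ha : a ≠ 0) :
    teich p a ^ (p - 1) = 1 := by
  unfold teich
  rw [← map_pow, ← map_pow, ZMod.pow_card_sub_one_eq_one ha, map_one, map_one]

theorem toZMod_teich (p : ℕ) [Fact p.Prime] (a : ZMod p) :
    PadicInt.toZMod (teich p a) = a := by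
  have huniq : ∀ (g : ℤ_[p] →+* ZMod p) (x : ℤ_[p]), g x = PadicInt.toZMod x := by
    intro g x
    have hmem : x - ((PadicInt.toZMod x).val : ℤ_[p]) ∈
        RingHom.ker (PadicInt.toZMod : ℤ_[p] →+* ZMod p) := by
      rw [RingHom.mem_ker, map_sub, map_natCast, ZMod.natCast_val, ZMod.cast_id', id, sub_self]
    rw [PadicInt.ker_toZMod, PadicInt.maximalIdeal_eq_span_p, Ideal.mem_span_singleton] at hmem
    obtain ⟨y, hy⟩ := hmem
    have hx : x = (p : ℤ_[p]) * y + ((PadicInt.toZMod x).val : ℤ_[p]) := by rw [← hy]; ring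
    conv_lhs => rw [hx]
    rw [map_add, map_mul, map_natCast, map_natCast, ZMod.natCast_val, ZMod.cast_id', id,
      CharP.cast_eq_zero, zero_mul, zero_add]
  have h := huniq ((WittVector.constantCoeff : WittVector p (ZMod p) →+* ZMod p).comp
    (WittVector.equiv p).symm.toRingHom) (teich p a)
  rw [← h]
  simp [teich, WittVector.constantCoeff, WittVector.teichmuller_coeff_zero]

/-- The Teichmüller character `ω`, as a Dirichlet character modulo `p` with values in `ℂ_[p]`. -/
def omega (p : ℕ) [Fact p.Prime] : DirichletCharacter ℂ_[p] p where
  toFun a := algebraMap ℚ_[p] ℂ_[p] (teich p a : ℚ_[p])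
  map_one' := by simp [teich]
  map_mul' a b := by simp [teich]
  map_nonunit' a ha := by
    have h0 : a = 0 := by simpa using ha
    simp [teich, h0, WittVector.teichmuller_zero]

/-- `⟨a⟩ = ω(a)⁻¹ a`, for an integer `a` prime to `p`. -/
def angle (p : ℕ) [Fact p.Prime] (a : ℕ) : ℚ_[p] :=
  ((teich p (a : ZMod p) : ℤ_[p]) : ℚ_[p])⁻¹ * (a : ℚ_[p])

/-- `⟨a⟩ ^ t = ∑ₙ (t choose n) (⟨a⟩ - 1) ^ n`, for `t ∈ ℤ_[p]` and an integer `a` prime to `p`. -/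
def anglePow (p : ℕ) [Fact p.Prime] (a : ℕ) (t : ℤ_[p]) : ℚ_[p] :=
  ∑' n : ℕ, ((Ring.choose t n : ℤ_[p]) : ℚ_[p]) * (angle p a - 1) ^ n

/-- The `p`-adic logarithm `log_p x = ∑_{n ≥ 1} (-1) ^ (n + 1) (x - 1) ^ n / n`,
for `x ∈ 1 + p ℤ_[p]`. -/
def padicLog (p : ℕ) [Fact p.Prime] (x : ℚ_[p]) : ℚ_[p] :=
  ∑' n : ℕ, (-1) ^ n * (x - 1) ^ (n + 1) / ((n : ℚ_[p]) + 1)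

/-- The inner series `∑ₙ (1 - s choose n) Bₙ (D / a) ^ n`. -/
def bernoulliSeries (p : ℕ) [Fact p.Prime] (D a : ℕ) (s : ℤ_[p]) : ℚ_[p] :=
  ∑' n : ℕ, ((Ring.choose (1 - s) n : ℤ_[p]) : ℚ_[p]) * ((bernoulli n : ℚ) : ℚ_[p]) *
    ((D : ℚ_[p]) / (a : ℚ_[p])) ^ n

/-- The explicit formula for `L_p(s, χ)` at `s ≠ 1`, for a primitive character `χ` modulo `f`:
`1/D · 1/(s-1) · ∑_{1 ≤ a ≤ D, (a, p) = 1} χ(a) ⟨a⟩^{1-s} ∑ₙ (1-s choose n) Bₙ (D/a)^n`,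
with the common multiple `D = p f` of `p` and `f`. -/
def padicLFormula (p : ℕ) [Fact p.Prime] {f : ℕ} (χ : DirichletCharacter ℂ_[p] f) (s : ℤ_[p]) :
    ℂ_[p] :=
  1 / ((p * f : ℕ) : ℂ_[p]) *
    (1 / (algebraMap ℚ_[p] ℂ_[p] (s : ℚ_[p]) - 1)) *
    ∑ a ∈ Finset.Icc 1 (p * f) with a.Coprime p,
      χ (a : ZMod f) *
        algebraMap ℚ_[p] ℂ_[p] (anglePow p a (1 - s) * bernoulliSeries p (p * f) a s)

/-- The `p`-adic `L`-function `L_p(s, χ)`, `s ∈ ℤ_[p]`. A character is replaced by the primitive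
character that induces it. For `s ≠ 1` this is the explicit formula; for `s = 1` (and `χ`
nontrivial) it is the value of the continuous extension. (At `s = 1` the function `L_p(s, 1)` of
the trivial character has a pole, and the value here is meaningless.) -/
def padicL (p : ℕ) [Fact p.Prime] {N : ℕ} (χ : DirichletCharacter ℂ_[p] N) (s : ℤ_[p]) : ℂ_[p] :=
  open Classical in
  if s = 1 then Filter.limUnder (𝓝[≠] (1 : ℤ_[p])) (padicLFormula p χ.primitiveCharacter)
  else padicLFormula p χ.primitiveCharacter s

/-- The finite set of primitive Dirichlet characters of conductor `f` with values in `ℂ_[p]`. -/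
def primitiveChars (p : ℕ) [Fact p.Prime] (f : ℕ) : Finset (DirichletCharacter ℂ_[p] f) :=
  open Classical in
  {ψ : DirichletCharacter ℂ_[p] f | ψ.IsPrimitive}

/-- `d(ψ, r, n) = ∏ (1 - ψ(q) q ^ n)`, over the primes `q` dividing `r / f`, where `f` is the
conductor of the primitive character `ψ`. -/
def eulerCorrection (p : ℕ) [Fact p.Prime] {f : ℕ} (ψ : DirichletCharacter ℂ_[p] f) (r : ℕ)
    (n : ℤ) : ℂ_[p] :=
  ∏ q ∈ (r / f).primeFactors, (1 - ψ (q : ZMod f) * (q : ℂ_[p]) ^ n)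

/-- The value `L_p(m, ψ ω ^ (1 - m))` at a natural number `m`. -/
def LValue (p : ℕ) [Fact p.Prime] {f : ℕ} (ψ : DirichletCharacter ℂ_[p] f) (m : ℕ) : ℂ_[p] :=
  padicL p (ψ.mul (omega p ^ (1 - (m : ℤ)))) (m : ℤ_[p])

/-- The Lehmer-type sum `∑ k ^ (-m)` over `1 ≤ k ≤ [d p / r]` with `(k, p) = 1`. -/
def lehmerSum (p : ℕ) [Fact p.Prime] (d r m : ℕ) : ℂ_[p] :=
  ∑ k ∈ Finset.Icc 1 (d * p / r) with k.Coprime p, 1 / (k : ℂ_[p]) ^ m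

/-- The summand
`(-m choose n) d(ψ, r, -m - n) L_p(m + n, ψ ω ^ (1 - m - n)) (d p) ^ n`. -/
def expansionTerm (p : ℕ) [Fact p.Prime] (d r m : ℕ) {f : ℕ} (ψ : DirichletCharacter ℂ_[p] f)
    (n : ℕ) : ℂ_[p] :=
  ((Ring.choose (-(m : ℤ)) n : ℤ) : ℂ_[p]) * eulerCorrection p ψ r (-(m : ℤ) - n) *
    LValue p ψ (m + n) * ((d * p : ℕ) : ℂ_[p]) ^ n

end Lehmer

end

/-!
The values `L_p(m, ψ ω ^ (1 - m))` at positive integers are averages. For a function `g` on the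
positive integers consider the limit of `X⁻¹ * ∑ g k` over `1 ≤ k ≤ X`, where `X` runs through
positive integers divisible by more and more integers, so that `X` tends to `0` in every `ℤ_[q]`.
The average of `t ^ j` is a Bernoulli number (`tendsto_powerMean`), and power series with summable
coefficients may be averaged term by term (`tendsto_mean_powerSeries`). With
`phi s k = k ^ (1 - s) / (s - 1)` for `k` prime to `p`, replaced by `-log_p k` for `s = 1`, and
`phi s k = 0` for `p ∣ k`, the explicit formula for the `p`-adic `L`-functions says that
`L_p(s, ψ ω ^ (1 - s))` is the average of `ψ k * phi s k` (`hasMean_LValue`). At `s = 1`,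
where the formula has the factor `1 / (s - 1)`, the value is the derivative of the remaining sum,
which vanishes there for nontrivial `ψ`.

The sum over `k ≤ d p / r` and the expansion are two evaluations of the average of
`phi m (k + d p)` over those `k` for which `r` divides `k + d p`.

* The Taylor expansion `phi m (k + y) = ∑ (-m choose n) phi (m + n) k y ^ n` (`hasSum_phi_add`) may
  be averaged termwise (`hasMean_phi_add`). The residue class `k = -d p` modulo `r` is picked out by
  the characters modulo `r`, that is, by the primitive characters of conductor `f ∣ r` sifted by the
  primes dividing `r / f` (`sum_primitiveChars_mul_sifted`). Since `phi` is homogeneous, sifting by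
  a prime multiplies an average by an Euler factor (`hasMean_sifted_phi`).
* Writing `k + d p = r (l + [d p / r])` and using homogeneity again, the average becomes that of
  `phi m (l + [d p / r])`. Shifting the argument by `M` changes the average by the sum of the
  derivatives of `phi m` at `1, …, M`, and the derivative of `phi m` at `l` is `-l ^ (-m)`
  (`hasMean_phi_shift`, `hasMean_residue`).

For `m = 1` the function `-log_p k` is homogeneous only up to a constant: dilating `k` by `q` adds
`-log_p q`. The dilation by `r` produces the logarithm of `r`. In the sieve the constants average to
zero for nontrivial characters; for the trivial character, whose term `n = 0` is missing from the
expansion, they produce the logarithms of the primes dividing `r` (`hasMean_sifted_one_phi_one`).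
-/

namespace Lehmer

open Filter Finset

/-! ### Averages of power series -/

/-- The filter on `ℕ` of positive integers tending to `0` multiplicatively, that is, of positive
integers that are eventually divisible by every given positive integer. -/
def toZero : Filter ℕ where
  sets := {S | ∃ n, 0 < n ∧ ∀ X, 0 < X → n ∣ X → X ∈ S}
  univ_sets := ⟨1, one_pos, fun _ _ _ => trivial⟩
  sets_of_superset := fun ⟨n, hn, h⟩ hST => ⟨n, hn, fun X hX hd => hST (h X hX hd)⟩
  inter_sets := fun ⟨n, hn, h⟩ ⟨m, hm, h'⟩ => ⟨n * m, Nat.mul_pos hn hm, fun X hX hd =>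
    ⟨h X hX (dvd_of_mul_right_dvd hd), h' X hX (dvd_of_mul_left_dvd hd)⟩⟩

theorem eventually_toZero {P : ℕ → Prop} :
    (∀ᶠ X in toZero, P X) ↔ ∃ n, 0 < n ∧ ∀ X, 0 < X → n ∣ X → P X := Iff.rfl

theorem eventually_toZero_dvd {n : ℕ} (hn : 0 < n) : ∀ᶠ X in toZero, 0 < X ∧ n ∣ X :=
  eventually_toZero.2 ⟨n, hn, fun _ h h' => ⟨h, h'⟩⟩

instance : NeBot toZero := by
  refine ⟨fun h => ?_⟩
  obtain ⟨n, hn, h⟩ := eventually_toZero.1 (by rw [h]; exact eventually_bot : ∀ᶠ _ in toZero, False)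
  exact h n hn dvd_rfl

theorem tendsto_div_toZero {q : ℕ} (hq : 0 < q) : Tendsto (fun X => X / q) toZero toZero := by
  rintro S ⟨n, hn, h⟩
  refine ⟨q * n, Nat.mul_pos hq hn, fun X hX hd => ?_⟩
  obtain ⟨c, rfl⟩ := hd
  have hc : 0 < c := Nat.pos_of_ne_zero (by rintro rfl; simp at hX)
  have : q * n * c / q = n * c := by rw [mul_assoc, Nat.mul_div_cancel_left _ hq]
  show q * n * c / q ∈ S
  rw [this]
  exact h _ (Nat.mul_pos hn hc) (dvd_mul_right n c)

theorem sum_range_mul {M : Type*} [AddCommMonoid M] (m k : ℕ) (f : ℕ → M) :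
    ∑ t ∈ range (m * k), f t = ∑ u ∈ range k, ∑ i ∈ range m, f (m * u + i) := by
  induction k with
  | zero => simp
  | succ k ih => rw [Nat.mul_succ, sum_range_add, ih, sum_range_succ]

variable (p : ℕ) [Fact p.Prime]

theorem norm_natCast_le_one (n : ℕ) : ‖(n : ℚ_[p])‖ ≤ 1 := by
  simpa using Padic.norm_int_le_one (p := p) (n : ℤ)

theorem norm_eq_one_of_not_dvd {k : ℕ} (hk : ¬ p ∣ k) : ‖(k : ℚ_[p])‖ = 1 :=
  Padic.norm_natCast_eq_one_iff.2 ((Nat.Prime.coprime_iff_not_dvd Fact.out).2 hk)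

theorem norm_lt_one_of_dvd {k : ℕ} (hk : p ∣ k) : ‖(k : ℚ_[p])‖ < 1 :=
  Padic.norm_natCast_lt_one_iff.2 hk

theorem inv_natCast_le_norm (n : ℕ) : ((n : ℝ) + 1)⁻¹ ≤ ‖((n : ℚ_[p]) + 1)‖ := by
  have h0 : ((n + 1 : ℕ) : ℚ_[p]) ≠ 0 := by exact_mod_cast (Nat.succ_ne_zero n)
  rw [← Nat.cast_succ, ← Nat.cast_succ, Padic.norm_eq_zpow_neg_valuation h0,
    Padic.valuation_natCast, zpow_neg, zpow_natCast]
  have hp : 0 < (p : ℝ) := by exact_mod_cast (Fact.out : p.Prime).pos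
  refine inv_anti₀ (by positivity) ?_
  exact_mod_cast Nat.le_of_dvd (Nat.succ_pos n) pow_padicValNat_dvd

theorem tendsto_natCast_toZero : Tendsto (fun X : ℕ => (X : ℚ_[p])) toZero (𝓝 0) := by
  rw [Metric.tendsto_nhds]
  intro ε hε
  obtain ⟨n, hn⟩ := exists_pow_lt_of_lt_one hε (Padic.norm_p_lt_one (p := p))
  refine (eventually_toZero_dvd (pow_pos (Fact.out : p.Prime).pos n)).mono ?_
  rintro X ⟨-, c, rfl⟩
  rw [dist_zero_right, Nat.cast_mul, Nat.cast_pow, norm_mul, norm_pow]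
  exact lt_of_le_of_lt (mul_le_of_le_one_right (by positivity) (norm_natCast_le_one p c)) hn

/-- The average of `t ^ j` over `0 ≤ t < n`. -/
noncomputable def powerMean (j n : ℕ) : ℚ_[p] := (n : ℚ_[p])⁻¹ * ∑ t ∈ range n, (t : ℚ_[p]) ^ j

/-- By Faulhaber's formula the averages of `t ^ j` tend to the Bernoulli number `B_j`. -/
theorem tendsto_powerMean (j : ℕ) :
    Tendsto (powerMean p j) toZero (𝓝 ((bernoulli j : ℚ) : ℚ_[p])) := by
  have h1 : ∀ᶠ n : ℕ in toZero, (∑ i ∈ range (j + 1), ((bernoulli i : ℚ) : ℚ_[p]) *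
      ((j + 1).choose i) * (n : ℚ_[p]) ^ (j - i) / (j + 1)) = powerMean p j n := by
    refine (eventually_toZero_dvd one_pos).mono fun n ⟨hn, _⟩ => ?_
    have hn0 : (n : ℚ_[p]) ≠ 0 := by exact_mod_cast hn.ne'
    have h := congrArg (fun x : ℚ => (x : ℚ_[p])) (sum_range_pow n j)
    push_cast at h
    rw [powerMean, h, mul_sum]
    refine sum_congr rfl fun i hi => ?_
    have hi' : i ≤ j := Nat.lt_succ_iff.1 (mem_range.1 hi)
    rw [Nat.succ_sub hi', pow_succ]
    field_simp
  refine Tendsto.congr' h1 ?_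
  have h2 : Tendsto (fun n : ℕ => ∑ i ∈ range (j + 1), ((bernoulli i : ℚ) : ℚ_[p]) *
      ((j + 1).choose i) * (n : ℚ_[p]) ^ (j - i) / (j + 1)) toZero
      (𝓝 (∑ i ∈ range (j + 1), ((bernoulli i : ℚ) : ℚ_[p]) *
      ((j + 1).choose i) * (0 : ℚ_[p]) ^ (j - i) / (j + 1))) :=
    tendsto_finsetSum _ fun i _ =>
      (((tendsto_natCast_toZero p).pow _).const_mul _).div_const _
  convert h2 using 2
  rw [sum_range_succ, sum_eq_zero, zero_add, Nat.sub_self, pow_zero, Nat.choose_succ_self_right]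
  · have : ((j : ℚ_[p]) + 1) ≠ 0 := by exact_mod_cast Nat.succ_ne_zero j
    push_cast
    field_simp
  · intro i hi
    rw [zero_pow (Nat.sub_ne_zero_of_lt (mem_range.1 hi))]
    simp

/-- A weak form of the von Staudt–Clausen theorem: it bounds the averages of `t ^ j`, and with them
the Bernoulli numbers, by `p`. -/
theorem natCast_dvd_mul_sum_pow (j n : ℕ) :
    (n : ℤ_[p]) ∣ (p : ℤ_[p]) * ∑ t ∈ range n, (t : ℤ_[p]) ^ j := by
  induction n using Nat.strong_induction_on with
  | _ n ih =>
  by_cases hpn : p ∣ n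
  -- the `p` blocks of length `m = n / p` have congruent sums modulo `m`
  · obtain ⟨m, rfl⟩ := hpn
    rcases Nat.eq_zero_or_pos m with rfl | hm
    · simp
    have hm' := ih m (lt_mul_of_one_lt_left hm (Fact.out : p.Prime).one_lt)
    have h1 : (m : ℤ_[p]) ∣ (∑ u ∈ range p, ∑ i ∈ range m, ((m * u + i : ℕ) : ℤ_[p]) ^ j)
        - ∑ u ∈ range p, ∑ i ∈ range m, (i : ℤ_[p]) ^ j := by
      simp only [← sum_sub_distrib]
      refine dvd_sum fun u _ => dvd_sum fun i _ => ?_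
      refine dvd_trans ?_ (sub_dvd_pow_sub_pow _ _ j)
      push_cast
      rw [add_sub_cancel_right]
      exact dvd_mul_right _ _
    rw [sum_const, card_range, nsmul_eq_mul] at h1
    have h2 := (dvd_sub_left hm').1 h1
    rw [← sum_range_mul m p fun t => (t : ℤ_[p]) ^ j, mul_comm m p] at h2
    rw [Nat.cast_mul]
    exact mul_dvd_mul_left _ h2
  · have : IsUnit (n : ℤ_[p]) := by
      rw [PadicInt.isUnit_iff, PadicInt.norm_natCast_eq_one_iff]
      exact (Nat.Prime.coprime_iff_not_dvd Fact.out).2 hpn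
    exact this.dvd

theorem norm_powerMean_le (j n : ℕ) : ‖powerMean p j n‖ ≤ p := by
  rcases Nat.eq_zero_or_pos n with rfl | hn
  · simp [powerMean]
  obtain ⟨z, hz⟩ := natCast_dvd_mul_sum_pow p j n
  have hn0 : (n : ℚ_[p]) ≠ 0 := by exact_mod_cast hn.ne'
  have hp0 : (p : ℚ_[p]) ≠ 0 := by exact_mod_cast (Fact.out : p.Prime).ne_zero
  have hz' := congrArg (fun x : ℤ_[p] => (x : ℚ_[p])) hz
  push_cast at hz'
  have : powerMean p j n = (p : ℚ_[p])⁻¹ * z := by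
    rw [powerMean]
    field_simp
    rw [mul_comm, ← hz', PadicInt.coe_sum]
    simp
  rw [this, norm_mul, norm_inv, Padic.norm_p, inv_inv]
  exact mul_le_of_le_one_right (by positivity) z.2

theorem norm_bernoulli_le (j : ℕ) : ‖((bernoulli j : ℚ) : ℚ_[p])‖ ≤ p :=
  le_of_tendsto (tendsto_powerMean p j).norm (Eventually.of_forall (norm_powerMean_le p j))

variable {p} {c : ℕ → ℚ_[p]} {f : ℕ → ℚ_[p]}

theorem hasSum_mul_powerMean
    (hf : ∀ t : ℕ, HasSum (fun j => c j * (t : ℚ_[p]) ^ j) (f t)) (n : ℕ) :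
    HasSum (fun j => c j * powerMean p j n) ((n : ℚ_[p])⁻¹ * ∑ t ∈ range n, f t) := by
  refine ((hasSum_sum (s := range n) fun t _ => hf t).mul_left ((n : ℚ_[p])⁻¹)).congr_fun
    fun j => ?_
  rw [powerMean, ← mul_sum]
  ring

/-- A power series with summable coefficients may be averaged term by term: the average of
`∑ c_j t ^ j` is `∑ c_j B_j`. -/
theorem tendsto_mean_powerSeries (hc : Summable fun j => ‖c j‖)
    (hf : ∀ t : ℕ, HasSum (fun j => c j * (t : ℚ_[p]) ^ j) (f t)) :
    Tendsto (fun n : ℕ => (n : ℚ_[p])⁻¹ * ∑ t ∈ range n, f t) toZero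
      (𝓝 (∑' j, c j * ((bernoulli j : ℚ) : ℚ_[p]))) := by
  simp_rw [← fun n => (hasSum_mul_powerMean hf n).tsum_eq]
  refine tendsto_tsum_of_dominated_convergence (bound := fun j => ‖c j‖ * p) (hc.mul_right _)
    (fun j => (tendsto_powerMean p j).const_mul _) (Eventually.of_forall fun n j => ?_)
  rw [norm_mul]
  exact mul_le_mul_of_nonneg_left (norm_powerMean_le p j n) (norm_nonneg _)

theorem norm_mean_powerSeries_le
    (hf : ∀ t : ℕ, HasSum (fun j => c j * (t : ℚ_[p]) ^ j) (f t)) {C : ℝ} (hC : ∀ j, ‖c j‖ ≤ C)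
    (n : ℕ) : ‖(n : ℚ_[p])⁻¹ * ∑ t ∈ range n, f t‖ ≤ C * p := by
  have hC0 : 0 ≤ C := (norm_nonneg _).trans (hC 0)
  rw [← (hasSum_mul_powerMean hf n).tsum_eq]
  refine IsUltrametricDist.norm_tsum_le_of_forall_le_of_nonneg (by positivity) fun j => ?_
  rw [norm_mul]
  exact mul_le_mul (hC j) (norm_powerMean_le p j n) (norm_nonneg _) hC0

/-! ### Binomial series and the `p`-adic logarithm -/

theorem summable_natCast_mul_geometric {ρ : ℝ} (h0 : 0 ≤ ρ) (h1 : ρ < 1) :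
    Summable fun n : ℕ => ((n : ℝ) + 1) * ρ ^ n := by
  have h := summable_pow_mul_geometric_of_norm_lt_one (R := ℝ) 1 (r := ρ)
    (by rwa [Real.norm_of_nonneg h0])
  simpa [add_mul] using h.add (summable_geometric_of_lt_one h0 h1)

theorem norm_div_natCast_le (x : ℚ_[p]) (n : ℕ) :
    ‖x / ((n : ℚ_[p]) + 1)‖ ≤ ‖x‖ * ((n : ℝ) + 1) := by
  rw [norm_div, div_eq_mul_inv]
  refine mul_le_mul_of_nonneg_left ?_ (norm_nonneg _)
  have h := inv_natCast_le_norm p n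
  have hn : 0 < (n : ℝ) + 1 := by positivity
  exact (inv_le_comm₀ (lt_of_lt_of_le (by positivity) h) hn).2 h

theorem choose_succ_eq (u : ℤ_[p]) (n : ℕ) :
    ((Ring.choose u (n + 1) : ℤ_[p]) : ℚ_[p]) =
      u * (((Ring.choose (u - 1) n : ℤ_[p]) : ℚ_[p]) / ((n : ℚ_[p]) + 1)) := by
  have h := Ring.choose_smul_choose u (n := n + 1) (k := 1) (by simp)
  rw [Nat.choose_one_right, Nat.add_sub_cancel, Ring.choose_one_right, Nat.cast_one,
    nsmul_eq_mul] at h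
  have h' := congrArg (fun x : ℤ_[p] => (x : ℚ_[p])) h
  push_cast at h'
  have hn : (n : ℚ_[p]) + 1 ≠ 0 := by exact_mod_cast Nat.succ_ne_zero n
  rw [mul_div_assoc', eq_div_iff hn, ← h', mul_comm]

theorem choose_neg_one (n : ℕ) : Ring.choose (-1 : ℤ_[p]) n = (-1) ^ n := by
  rw [Ring.choose_neg, show (1 : ℤ_[p]) + n - 1 = (n : ℕ) by ring, Ring.choose_natCast,
    Nat.choose_self]
  rcases Nat.even_or_odd n with h | h
  · rw [Int.negOnePow_even _ (by exact_mod_cast h), h.neg_one_pow]; simp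
  · rw [Int.negOnePow_odd _ (by exact_mod_cast h), h.neg_one_pow]; simp

/-- The derivative at `u = 0` of a binomial series `∑ (u choose n) b_n`. -/
theorem tendsto_binomialSeries_slope {b : ℕ → ℚ_[p]} {ρ C : ℝ} (h0 : 0 ≤ ρ) (h1 : ρ < 1)
    (hb : ∀ n, ‖b n‖ ≤ C * ρ ^ n) :
    Tendsto (fun u : ℤ_[p] => (∑' n, ((Ring.choose u n : ℤ_[p]) : ℚ_[p]) * b n - b 0) / u)
      (𝓝[≠] 0) (𝓝 (∑' n : ℕ, (-1) ^ n * b (n + 1) / ((n : ℚ_[p]) + 1))) := by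
  have hC : 0 ≤ C := by simpa using (norm_nonneg _).trans (hb 0)
  have hsum : ∀ u : ℤ_[p], Summable fun n => ((Ring.choose u n : ℤ_[p]) : ℚ_[p]) * b n := by
    intro u
    refine Summable.of_norm_bounded ((summable_geometric_of_lt_one h0 h1).mul_left C) fun n => ?_
    rw [norm_mul]
    exact (mul_le_of_le_one_left (norm_nonneg _) (PadicInt.norm_le_one _)).trans (hb n)
  have h2 : Tendsto (fun u : ℤ_[p] => ∑' n : ℕ, ((Ring.choose (u - 1) n : ℤ_[p]) : ℚ_[p]) *
      b (n + 1) / ((n : ℚ_[p]) + 1)) (𝓝 0)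
      (𝓝 (∑' n : ℕ, (-1) ^ n * b (n + 1) / ((n : ℚ_[p]) + 1))) := by
    refine tendsto_tsum_of_dominated_convergence
      (bound := fun n : ℕ => C * ρ * (((n : ℝ) + 1) * ρ ^ n))
      ((summable_natCast_mul_geometric h0 h1).mul_left _) (fun n => ?_)
      (Eventually.of_forall fun u n => ?_)
    · have hc : Continuous fun u : ℤ_[p] => ((Ring.choose (u - 1) n : ℤ_[p]) : ℚ_[p]) :=
        continuous_subtype_val.comp
          ((PadicInt.continuous_choose n).comp (continuous_id.sub continuous_const))
      have := ((hc.tendsto 0).mul_const (b (n + 1))).div_const ((n : ℚ_[p]) + 1)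
      rw [zero_sub, choose_neg_one] at this
      simpa using this
    · refine (norm_div_natCast_le _ n).trans ?_
      rw [norm_mul]
      have h3 := (mul_le_of_le_one_left (norm_nonneg (b (n + 1)))
        (PadicInt.norm_le_one (Ring.choose (u - 1) n))).trans (hb (n + 1))
      refine (mul_le_mul_of_nonneg_right h3 (by positivity)).trans (le_of_eq ?_)
      rw [pow_succ]; ring
  refine (h2.mono_left nhdsWithin_le_nhds).congr' ?_
  filter_upwards [self_mem_nhdsWithin] with u hu
  have hu0 : (u : ℚ_[p]) ≠ 0 := by
    intro h; exact hu (by simpa using h)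
  rw [(hsum u).tsum_eq_zero_add, Ring.choose_zero_right]
  simp only [PadicInt.coe_one, one_mul, add_sub_cancel_left]
  rw [eq_div_iff hu0, ← tsum_mul_right]
  refine tsum_congr fun n => ?_
  rw [choose_succ_eq]
  ring

/-- The binomial series `(1 + x) ^ u = ∑ (u choose n) x ^ n`. -/
noncomputable def binom (x : ℚ_[p]) (u : ℤ_[p]) : ℚ_[p] :=
  ∑' n : ℕ, ((Ring.choose u n : ℤ_[p]) : ℚ_[p]) * x ^ n

theorem choose_intCast (z : ℤ) (n : ℕ) :
    ((Ring.choose (z : ℤ_[p]) n : ℤ_[p]) : ℚ_[p]) = ((Ring.choose z n : ℤ) : ℚ_[p]) := by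
  have h := Ring.map_choose (Int.castRingHom ℤ_[p]) z n
  simp only [eq_intCast] at h
  rw [← h, PadicInt.coe_intCast]

theorem hasSum_binom {x : ℚ_[p]} (hx : ‖x‖ < 1) (u : ℤ_[p]) :
    HasSum (fun n : ℕ => ((Ring.choose u n : ℤ_[p]) : ℚ_[p]) * x ^ n) (binom x u) := by
  refine Summable.hasSum
    (Summable.of_norm_bounded (summable_geometric_of_lt_one (norm_nonneg x) hx) fun n => ?_)
  rw [norm_mul, norm_pow]
  exact mul_le_of_le_one_left (by positivity) (PadicInt.norm_le_one _)

theorem binom_intCast {x : ℚ_[p]} (hx : ‖x‖ < 1) (z : ℤ) :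
    binom x (z : ℤ_[p]) = (1 + x) ^ z := by
  have : IsBoundedSMul ℤ_[p] ℚ_[p] := .of_norm_smul_le fun a b => by
    rw [Algebra.smul_def, norm_mul]; exact le_rfl
  have hr : Tendsto (x ^ ·) atTop (𝓝 0) := tendsto_pow_atTop_nhds_zero_of_norm_lt_one hx
  have h : ∀ u : ℤ_[p], PadicInt.addChar_of_value_at_one x hr u = binom x u := by
    intro u
    rw [PadicInt.coe_addChar_of_value_at_one, PadicInt.mahlerSeries_apply hr]
    rfl
  rw [← h, ← zsmul_one z, AddChar.map_zsmul_eq_zpow, PadicInt.addChar_of_value_at_one_def]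

theorem hasSum_choose_mul_pow {x : ℚ_[p]} (hx : ‖x‖ < 1) (z : ℤ) :
    HasSum (fun n : ℕ => ((Ring.choose z n : ℤ) : ℚ_[p]) * x ^ n) ((1 + x) ^ z) := by
  have := hasSum_binom hx (z : ℤ_[p])
  simpa only [choose_intCast, binom_intCast hx] using this

theorem tendsto_binom_slope {x : ℚ_[p]} (hx : ‖x‖ < 1) :
    Tendsto (fun u : ℤ_[p] => (binom x u - 1) / u) (𝓝[≠] 0) (𝓝 (padicLog p (1 + x))) := by
  have := tendsto_binomialSeries_slope (b := fun n => x ^ n) (C := 1) (norm_nonneg x) hx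
    (fun n => by simp)
  simpa [padicLog, binom] using this

theorem tendsto_pow_slope {x : ℚ_[p]} (hx : ‖x - 1‖ < 1) :
    Tendsto (fun N : ℕ => (x ^ (p ^ N) - 1) / (p : ℚ_[p]) ^ N) atTop (𝓝 (padicLog p x)) := by
  have h1 : Tendsto (fun N : ℕ => (p : ℤ_[p]) ^ N) atTop (𝓝[≠] 0) := by
    refine tendsto_nhdsWithin_iff.2 ⟨tendsto_pow_atTop_nhds_zero_of_norm_lt_one ?_,
      Eventually.of_forall fun N => pow_ne_zero _ ?_⟩
    · exact PadicInt.norm_natCast_lt_one_iff.2 dvd_rfl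
    · exact_mod_cast (Fact.out : p.Prime).ne_zero
  have h2 := (tendsto_binom_slope hx).comp h1
  rw [add_sub_cancel] at h2
  refine h2.congr fun N => ?_
  have h3 := binom_intCast hx ((p ^ N : ℕ) : ℤ)
  rw [zpow_natCast, add_sub_cancel] at h3
  simp only [Function.comp]
  rw [← h3]
  push_cast
  rfl

theorem norm_mul_sub_one_lt {x y : ℚ_[p]} (hx : ‖x - 1‖ < 1) (hy : ‖y - 1‖ < 1) :
    ‖x * y - 1‖ < 1 := by
  have hy1 : ‖y‖ ≤ 1 := by
    rw [← sub_add_cancel y 1]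
    exact (Padic.nonarchimedean _ _).trans (by simp [hy.le])
  rw [show x * y - 1 = (x - 1) * y + (y - 1) by ring]
  refine (Padic.nonarchimedean _ _).trans_lt (max_lt ?_ hy)
  rw [norm_mul]
  exact (mul_le_of_le_one_right (norm_nonneg _) hy1).trans_lt hx

/-- Since `log x` is the limit of `(x ^ u - 1) / u` for `u → 0`, the logarithm is additive. -/
theorem padicLog_mul {x y : ℚ_[p]} (hx : ‖x - 1‖ < 1) (hy : ‖y - 1‖ < 1) :
    padicLog p (x * y) = padicLog p x + padicLog p y := by
  have hp : ∀ N : ℕ, (p : ℚ_[p]) ^ N ≠ 0 := fun N =>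
    pow_ne_zero _ (by exact_mod_cast (Fact.out : p.Prime).ne_zero)
  have h0 : Tendsto (fun N : ℕ => (p : ℚ_[p]) ^ N) atTop (𝓝 0) :=
    tendsto_pow_atTop_nhds_zero_of_norm_lt_one Padic.norm_p_lt_one
  have h1 := tendsto_pow_slope hx
  have h2 := tendsto_pow_slope hy
  have h3 := h1.add (h2.add ((h1.mul h2).mul h0))
  rw [mul_zero, add_zero] at h3
  refine tendsto_nhds_unique (tendsto_pow_slope (norm_mul_sub_one_lt hx hy)) (h3.congr fun N => ?_)
  have := hp N
  rw [mul_pow]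
  field_simp
  ring

theorem norm_pow_sub_one_lt {x : ℚ_[p]} (hx : ‖x - 1‖ < 1) (n : ℕ) : ‖x ^ n - 1‖ < 1 := by
  induction n with
  | zero => simp
  | succ n ih => rw [pow_succ]; exact norm_mul_sub_one_lt ih hx

theorem padicLog_one : padicLog p 1 = 0 := by simp [padicLog]

theorem padicLog_pow {x : ℚ_[p]} (hx : ‖x - 1‖ < 1) (n : ℕ) :
    padicLog p (x ^ n) = n * padicLog p x := by
  induction n with
  | zero => simp [padicLog_one]
  | succ n ih =>
    rw [pow_succ, padicLog_mul (norm_pow_sub_one_lt hx n) hx, ih]; push_cast; ring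

theorem hasSum_padicLog {x : ℚ_[p]} (hx : ‖x‖ < 1) :
    HasSum (fun n : ℕ => (-1) ^ n * x ^ (n + 1) / ((n : ℚ_[p]) + 1)) (padicLog p (1 + x)) := by
  have h : Summable (fun n : ℕ => (-1) ^ n * x ^ (n + 1) / ((n : ℚ_[p]) + 1)) := by
    refine Summable.of_norm_bounded (g := fun n : ℕ => ‖x‖ * (((n : ℝ) + 1) * ‖x‖ ^ n))
      ((summable_natCast_mul_geometric (norm_nonneg x) hx).mul_left _) fun n => ?_
    refine (norm_div_natCast_le _ n).trans (le_of_eq ?_)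
    simp [pow_succ]
    ring
  have := h.hasSum
  rwa [padicLog, show (1 + x - 1) = x by ring]

/-! ### The functions that are averaged -/

variable (p) in
/-- The logarithm `log_p k = log_p (k ^ (p - 1)) / (p - 1)` of an integer `k` prime to `p`; this is
`log_p ⟨k⟩`. -/
noncomputable def logUnit (k : ℕ) : ℚ_[p] := padicLog p ((k : ℚ_[p]) ^ (p - 1)) / ((p : ℚ_[p]) - 1)

theorem p_sub_one_ne_zero : (p : ℚ_[p]) - 1 ≠ 0 := by
  rw [sub_ne_zero]
  exact_mod_cast (Fact.out : p.Prime).one_lt.ne'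

theorem norm_natCast_pow_sub_one_lt {k : ℕ} (hk : ¬ p ∣ k) :
    ‖(k : ℚ_[p]) ^ (p - 1) - 1‖ < 1 := by
  have h : ((k : ZMod p)) ^ (p - 1) = 1 :=
    ZMod.pow_card_sub_one_eq_one (by rwa [Ne, ZMod.natCast_eq_zero_iff])
  have h2 : (p : ℤ) ∣ (k : ℤ) ^ (p - 1) - 1 := by
    rw [← ZMod.intCast_zmod_eq_zero_iff_dvd]
    push_cast
    rw [h, sub_self]
  have := Padic.norm_intCast_lt_one_iff.2 h2
  simpa using this

theorem logUnit_mul {k l : ℕ} (hk : ¬ p ∣ k) (hl : ¬ p ∣ l) :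
    logUnit p (k * l) = logUnit p k + logUnit p l := by
  rw [logUnit, Nat.cast_mul, mul_pow,
    padicLog_mul (norm_natCast_pow_sub_one_lt hk) (norm_natCast_pow_sub_one_lt hl), add_div]
  rfl

theorem not_dvd_add {p k y : ℕ} (hk : ¬ p ∣ k) (hy : p ∣ y) : ¬ p ∣ k + y :=
  fun h => hk ((Nat.dvd_add_left hy).1 h)

theorem norm_div_lt_one {k y : ℕ} (hk : ¬ p ∣ k) (hy : p ∣ y) :
    ‖(y : ℚ_[p]) / (k : ℚ_[p])‖ < 1 := by
  rw [norm_div, norm_eq_one_of_not_dvd p hk, div_one]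
  exact norm_lt_one_of_dvd p hy

theorem natCast_ne_zero_of_not_dvd {k : ℕ} (hk : ¬ p ∣ k) : (k : ℚ_[p]) ≠ 0 := by
  intro h
  have := norm_eq_one_of_not_dvd p hk
  simp [h] at this

theorem logUnit_add {k y : ℕ} (hk : ¬ p ∣ k) (hy : p ∣ y) :
    logUnit p (k + y) = logUnit p k + padicLog p (1 + (y : ℚ_[p]) / k) := by
  have hk0 := natCast_ne_zero_of_not_dvd hk
  have hx := norm_div_lt_one hk hy
  have hx' : ‖1 + (y : ℚ_[p]) / k - 1‖ < 1 := by rwa [add_sub_cancel_left]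
  have h : ((k + y : ℕ) : ℚ_[p]) ^ (p - 1) =
      (k : ℚ_[p]) ^ (p - 1) * (1 + (y : ℚ_[p]) / k) ^ (p - 1) := by
    rw [← mul_pow]; congr 1; push_cast; field_simp
  have hp := p_sub_one_ne_zero (p := p)
  rw [logUnit, h, padicLog_mul (norm_natCast_pow_sub_one_lt hk) (norm_pow_sub_one_lt hx' _),
    padicLog_pow hx', Nat.cast_sub (Fact.out : p.Prime).one_lt.le, logUnit, Nat.cast_one, add_div,
    mul_div_cancel_left₀ _ hp]

variable (p) in
/-- The function of `k` whose average, weighted by a character `ψ`, is `LValue p ψ s`: it vanishes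
at the multiples of `p`, and elsewhere it is `k ^ (1 - s) / (s - 1)`, or `-log_p k` if `s = 1`. -/
noncomputable def phi (s k : ℕ) : ℚ_[p] :=
  if p ∣ k then 0 else if s = 1 then -logUnit p k
  else (k : ℚ_[p]) ^ (1 - (s : ℤ)) / ((s : ℚ_[p]) - 1)

theorem phi_of_dvd {s k : ℕ} (hk : p ∣ k) : phi p s k = 0 := if_pos hk

theorem phi_one {k : ℕ} (hk : ¬ p ∣ k) : phi p 1 k = -logUnit p k := by simp [phi, hk]

theorem phi_of_ne_one {s k : ℕ} (hs : s ≠ 1) (hk : ¬ p ∣ k) :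
    phi p s k = (k : ℚ_[p]) ^ (1 - (s : ℤ)) / ((s : ℚ_[p]) - 1) := by simp [phi, hk, hs]

theorem choose_neg_natCast (s n : ℕ) :
    Ring.choose (-((s : ℤ) + 1)) n = (-1) ^ n * ((s + n).choose n : ℤ) := by
  rw [Ring.choose_neg, show ((s : ℤ) + 1 + n - 1) = ((s + n : ℕ) : ℤ) by push_cast; ring,
    Ring.choose_natCast]
  rcases Nat.even_or_odd n with h | h
  · rw [Int.negOnePow_even _ (by exact_mod_cast h), h.neg_one_pow]; simp
  · rw [Int.negOnePow_odd _ (by exact_mod_cast h), h.neg_one_pow]; simp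

theorem choose_mul_phi {s k : ℕ} (hs : 2 ≤ s) (hk : ¬ p ∣ k) (n : ℕ) :
    ((Ring.choose (-(s : ℤ)) n : ℤ) : ℚ_[p]) * phi p (s + n) k =
      phi p s k * (((Ring.choose (1 - (s : ℤ)) n : ℤ) : ℚ_[p]) * ((k : ℚ_[p]) ^ n)⁻¹) := by
  obtain ⟨u, rfl⟩ : ∃ u, s = u + 2 := ⟨s - 2, by lia⟩
  have hk0 := natCast_ne_zero_of_not_dvd hk
  have hu : (u : ℚ_[p]) + 1 ≠ 0 := by exact_mod_cast Nat.succ_ne_zero u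
  have hun : (u : ℚ_[p]) + n + 1 ≠ 0 := by exact_mod_cast Nat.succ_ne_zero (u + n)
  have h1 := choose_neg_natCast (u + 1) n
  have h2 := choose_neg_natCast u n
  have h3 := Nat.choose_mul_succ_eq (u + n) n
  rw [show u + n + 1 - n = u + 1 by lia] at h3
  have h4 := congrArg (fun x : ℕ => (x : ℚ_[p])) h3
  rw [show (1 - ((u + 2 : ℕ) : ℤ)) = -((u : ℤ) + 1) by push_cast; ring, h2,
    show (-((u + 2 : ℕ) : ℤ)) = -(((u + 1 : ℕ) : ℤ) + 1) by push_cast; ring, h1,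
    phi_of_ne_one (by lia) hk, phi_of_ne_one (by lia) hk,
    show (1 - ((u + 2 : ℕ) : ℤ)) = -((u : ℤ) + 1) by push_cast; ring,
    show (1 - ((u + 2 + n : ℕ) : ℤ)) = -((u : ℤ) + 1) - (n : ℤ) by push_cast; ring,
    zpow_sub₀ hk0, zpow_natCast, show u + 1 + n = u + n + 1 by ring]
  push_cast at h4 ⊢
  rw [show ((u : ℚ_[p]) + 2 + n - 1) = u + n + 1 by ring,
    show ((u : ℚ_[p]) + 2 - 1) = u + 1 by ring]
  field_simp
  linear_combination -h4

theorem choose_mul_phi_one {k : ℕ} (hk : ¬ p ∣ k) (n : ℕ) :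
    ((Ring.choose (-((1 : ℕ) : ℤ)) (n + 1) : ℤ) : ℚ_[p]) * phi p (1 + (n + 1)) k =
      -((-1) ^ n * ((k : ℚ_[p]) ^ (n + 1))⁻¹ / ((n : ℚ_[p]) + 1)) := by
  have h1 := choose_neg_natCast 0 (n + 1)
  simp only [Nat.cast_zero, zero_add, Nat.choose_self, Nat.cast_one, mul_one] at h1
  rw [Nat.cast_one, h1, phi_of_ne_one (by lia) hk,
    show (1 - ((1 + (n + 1) : ℕ) : ℤ)) = -((n + 1 : ℕ) : ℤ) by push_cast; ring, zpow_neg,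
    zpow_natCast]
  push_cast
  rw [show (1 + ((n : ℚ_[p]) + 1) - 1) = n + 1 by ring]
  ring

/-- The Taylor expansion of `phi` at `k` has the same shape for all `s ≥ 1`. -/
theorem hasSum_phi_add {s k y : ℕ} (hs : 1 ≤ s) (hk : ¬ p ∣ k) (hy : p ∣ y) :
    HasSum (fun n : ℕ => ((Ring.choose (-(s : ℤ)) n : ℤ) : ℚ_[p]) * phi p (s + n) k *
      (y : ℚ_[p]) ^ n) (phi p s (k + y)) := by
  have hk0 := natCast_ne_zero_of_not_dvd hk
  have hx := norm_div_lt_one hk hy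
  have hky := not_dvd_add hk hy
  rcases hs.eq_or_lt with rfl | hs
  · rw [phi_one hky, logUnit_add hk hy, neg_add]
    rw [← hasSum_nat_add_iff' 1]
    simp only [sum_range_one, add_zero, phi_one hk, Ring.choose_zero_right, pow_zero, Int.cast_one,
      one_mul, mul_one, add_sub_cancel_left]
    refine (hasSum_padicLog hx).neg.congr_fun fun n => ?_
    rw [choose_mul_phi_one hk, div_pow]
    ring
  · have h : ((k + y : ℕ) : ℚ_[p]) = k * (1 + (y : ℚ_[p]) / k) := by push_cast; field_simp
    rw [phi_of_ne_one hs.ne' hky, h, mul_zpow, mul_div_right_comm, ← phi_of_ne_one hs.ne' hk]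
    refine ((hasSum_choose_mul_pow hx (1 - (s : ℤ))).mul_left _).congr_fun fun n => ?_
    rw [choose_mul_phi hs hk, div_pow]
    ring

variable (p) in
/-- The defect of homogeneity of `phi`, which occurs only at `s = 1`. -/
noncomputable def phiDefect (s q : ℕ) : ℚ_[p] := if s = 1 then -logUnit p q else 0

theorem phi_mul {s q : ℕ} (hq : ¬ p ∣ q) (k : ℕ) :
    phi p s (q * k) = (q : ℚ_[p]) ^ (1 - (s : ℤ)) * phi p s k +
      phiDefect p s q * (if p ∣ k then 0 else 1) := by
  by_cases hk : p ∣ k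
  · rw [phi_of_dvd hk, phi_of_dvd (hk.mul_left q)]; simp [hk]
  have hqk : ¬ p ∣ q * k := fun h => ((Fact.out : p.Prime).dvd_mul.1 h).elim hq hk
  rw [if_neg hk]
  by_cases hs : s = 1
  · subst hs
    rw [phi_one hqk, phi_one hk, logUnit_mul hq hk]
    simp [phiDefect]
  · rw [phi_of_ne_one hs hqk, phi_of_ne_one hs hk]
    simp [phiDefect, hs, mul_zpow, mul_div_assoc]

/-! ### Means of functions with values in `ℂ_[p]` -/

theorem sum_Icc_one {M : Type*} [AddCommMonoid M] (X : ℕ) (f : ℕ → M) :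
    ∑ k ∈ Icc 1 X, f k = ∑ i ∈ range X, f (i + 1) := by
  rw [range_eq_Ico, sum_Ico_add' f 0 X 1]
  rfl

theorem sum_Icc_one_mul {M : Type*} [AddCommMonoid M] (D n : ℕ) (f : ℕ → M) :
    ∑ k ∈ Icc 1 (D * n), f k = ∑ a ∈ Icc 1 D, ∑ t ∈ range n, f (a + D * t) := by
  rw [sum_Icc_one, sum_range_mul, sum_comm, sum_Icc_one]
  refine sum_congr rfl fun i _ => sum_congr rfl fun t _ => ?_
  congr 1
  ring

/-- `HasMean g L` says that the averages of `g` over `1 ≤ k ≤ X` tend to `L` as `X` tends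
multiplicatively to `0`. -/
def HasMean (g : ℕ → ℂ_[p]) (L : ℂ_[p]) : Prop :=
  Tendsto (fun X : ℕ => (X : ℂ_[p])⁻¹ * ∑ k ∈ Icc 1 X, g k) toZero (𝓝 L)

namespace HasMean

variable {g h : ℕ → ℂ_[p]} {L L' : ℂ_[p]}

theorem unique (hg : HasMean g L) (hg' : HasMean g L') : L = L' := tendsto_nhds_unique hg hg'

theorem congr (hg : HasMean g L) (hgh : ∀ k, g k = h k) : HasMean h L := by
  obtain rfl : g = h := funext hgh
  exact hg

theorem add (hg : HasMean g L) (hh : HasMean h L') : HasMean (fun k => g k + h k) (L + L') :=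
  (Tendsto.add hg hh).congr fun X => by rw [sum_add_distrib, mul_add]

theorem sub (hg : HasMean g L) (hh : HasMean h L') : HasMean (fun k => g k - h k) (L - L') :=
  (Tendsto.sub hg hh).congr fun X => by rw [sum_sub_distrib, mul_sub]

theorem const_mul (c : ℂ_[p]) (hg : HasMean g L) : HasMean (fun k => c * g k) (c * L) :=
  (Tendsto.const_mul c hg).congr fun X => by rw [← mul_sum, mul_left_comm]

theorem sum {ι : Type*} {s : Finset ι} {g : ι → ℕ → ℂ_[p]} {L : ι → ℂ_[p]}
    (hg : ∀ i ∈ s, HasMean (g i) (L i)) :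
    HasMean (fun k => ∑ i ∈ s, g i k) (∑ i ∈ s, L i) :=
  (tendsto_finsetSum s hg).congr fun X => by rw [sum_comm, mul_sum]

/-- The average may be computed along the residue classes modulo `D`. -/
theorem of_classes {D : ℕ} (hD : 0 < D) {Z : ℕ → ℂ_[p]}
    (hZ : ∀ a ∈ Icc 1 D, Tendsto (fun n : ℕ => (n : ℂ_[p])⁻¹ * ∑ t ∈ range n, g (a + D * t)) toZero
      (𝓝 (Z a))) :
    HasMean g ((D : ℂ_[p])⁻¹ * ∑ a ∈ Icc 1 D, Z a) := by
  have h1 := ((tendsto_finsetSum (Icc 1 D) hZ).const_mul (D : ℂ_[p])⁻¹).comp (tendsto_div_toZero hD)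
  refine Tendsto.congr' ?_ h1
  filter_upwards [eventually_toZero_dvd hD] with X ⟨_, n, hn⟩
  subst hn
  simp only [Function.comp, Nat.mul_div_cancel_left _ hD]
  rw [sum_Icc_one_mul, ← mul_sum, ← mul_assoc, Nat.cast_mul, mul_inv]

/-- The multiples of `q` have density `q⁻¹`. -/
theorem dilate {q : ℕ} (hq : 0 < q) (hg : HasMean g L) (hgh : ∀ j, h (q * j) = g j) :
    HasMean (fun k => if q ∣ k then h k else 0) ((q : ℂ_[p])⁻¹ * L) := by
  have h1 := (Tendsto.const_mul (q : ℂ_[p])⁻¹ hg).comp (tendsto_div_toZero hq)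
  refine Tendsto.congr' ?_ h1
  filter_upwards [eventually_toZero_dvd hq] with X ⟨_, n, hn⟩
  subst hn
  simp only [Function.comp, Nat.mul_div_cancel_left _ hq]
  have key : ∑ k ∈ Icc 1 (q * n), (if q ∣ k then h k else 0) = ∑ j ∈ Icc 1 n, g j := by
    rw [sum_Icc_one_mul, sum_Icc_one n, sum_eq_single_of_mem q (mem_Icc.2 ⟨hq, le_rfl⟩)]
    · refine sum_congr rfl fun t _ => ?_
      rw [if_pos ((dvd_refl q).add (dvd_mul_right q t)), ← hgh]
      congr 1
      ring
    · intro a ha haq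
      refine sum_eq_zero fun t _ => if_neg fun hd => ?_
      rw [mem_Icc] at ha
      have := Nat.le_of_dvd (by lia) ((Nat.dvd_add_left (dvd_mul_right q t)).1 hd)
      lia
  rw [key, ← mul_assoc, Nat.cast_mul, mul_inv]

theorem sieve {q : ℕ} (hq : 0 < q) (hh : HasMean h L) (hg : HasMean g L')
    (hgh : ∀ j, h (q * j) = g j) :
    HasMean (fun k => if q ∣ k then 0 else h k) (L - (q : ℂ_[p])⁻¹ * L') :=
  (hh.sub (hg.dilate hq hgh)).congr fun k => by split_ifs <;> simp

end HasMean

theorem hasMean_one : HasMean (fun _ => (1 : ℂ_[p])) 1 := by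
  refine Tendsto.congr' ?_ tendsto_const_nhds
  filter_upwards [eventually_toZero_dvd one_pos] with X ⟨hX, _⟩
  have : (X : ℂ_[p]) ≠ 0 := by exact_mod_cast hX.ne'
  simp [this]

theorem sum_Icc_zmod {f : ℕ} (hf : 0 < f) (ψ : DirichletCharacter ℂ_[p] f) (hψ : ψ ≠ 1) :
    ∑ a ∈ Icc 1 f, ψ (a : ZMod f) = 0 := by
  have : NeZero f := ⟨hf.ne'⟩
  rw [← MulChar.sum_eq_zero_of_ne_one hψ]
  have h0 : ∑ a ∈ Icc 1 f, ψ (a : ZMod f) = ∑ a ∈ range f, ψ (a : ZMod f) := by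
    rw [sum_Icc_one]
    have h1 := sum_range_succ (fun a : ℕ => ψ (a : ZMod f)) f
    rw [sum_range_succ'] at h1
    simpa using h1
  rw [h0]
  refine sum_bij (fun a _ => (a : ZMod f)) (fun _ _ => mem_univ _) ?_ ?_ (fun _ _ => rfl)
  · intro a ha b hb hab
    rw [mem_range] at ha hb
    have := (ZMod.natCast_eq_natCast_iff' a b f).1 hab
    rwa [Nat.mod_eq_of_lt ha, Nat.mod_eq_of_lt hb] at this
  · intro b _
    exact ⟨b.val, mem_range.2 (ZMod.val_lt b), by simp⟩

theorem hasMean_char {f : ℕ} (hf : 0 < f) {ψ : DirichletCharacter ℂ_[p] f} (hψ : ψ ≠ 1) :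
    HasMean (fun k => ψ (k : ZMod f)) 0 := by
  refine Tendsto.congr' ?_ tendsto_const_nhds
  filter_upwards [eventually_toZero_dvd hf] with X ⟨_, n, hn⟩
  subst hn
  rw [sum_Icc_one_mul]
  simp [← mul_sum, sum_Icc_zmod hf ψ hψ]

/-! ### Averages of `phi` -/

variable (p) in
/-- For `a` prime to `p` and `p ∣ D`, the average of `phi s` over the residue class of `a` modulo
`D`, as the series that results from averaging the Taylor expansion at `a`. -/
noncomputable def classMean (s a D : ℕ) : ℚ_[p] :=
  ∑' n : ℕ, ((Ring.choose (-(s : ℤ)) n : ℤ) : ℚ_[p]) * phi p (s + n) a * (D : ℚ_[p]) ^ n *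
    ((bernoulli n : ℚ) : ℚ_[p])

theorem norm_intCast_le_one (z : ℤ) : ‖(z : ℚ_[p])‖ ≤ 1 := Padic.norm_int_le_one z

theorem norm_phi_le_of_two_le {s : ℕ} (hs : 2 ≤ s) (k : ℕ) : ‖phi p s k‖ ≤ s := by
  by_cases hk : p ∣ k
  · rw [phi_of_dvd hk, norm_zero]; positivity
  obtain ⟨u, rfl⟩ : ∃ u, s = u + 2 := ⟨s - 2, by lia⟩
  have h := norm_div_natCast_le ((k : ℚ_[p]) ^ (1 - ((u + 2 : ℕ) : ℤ))) u
  rw [norm_zpow, norm_eq_one_of_not_dvd p hk, one_zpow, one_mul] at h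
  rw [phi_of_ne_one (by lia) hk]
  push_cast at h ⊢
  rw [show (u : ℚ_[p]) + 2 - 1 = u + 1 by ring]
  linarith

theorem norm_phi_le {s : ℕ} (hs : 1 ≤ s) (k : ℕ) : ‖phi p s k‖ ≤ ‖phi p 1 k‖ + s := by
  rcases hs.eq_or_lt with rfl | hs
  · simp
  · linarith [norm_phi_le_of_two_le (p := p) hs k, norm_nonneg (phi p 1 k)]

theorem summable_phi_coeff {s : ℕ} (hs : 1 ≤ s) (a D : ℕ) (hD : p ∣ D) :
    Summable fun n : ℕ => ‖((Ring.choose (-(s : ℤ)) n : ℤ) : ℚ_[p]) * phi p (s + n) a *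
      (D : ℚ_[p]) ^ n‖ := by
  have hρ := norm_lt_one_of_dvd p hD
  refine Summable.of_nonneg_of_le (fun _ => norm_nonneg _) (fun n => ?_)
    ((summable_natCast_mul_geometric (norm_nonneg (D : ℚ_[p])) hρ).mul_left
      (‖phi p 1 a‖ + s + 1))
  rw [norm_mul, norm_mul, norm_pow, ← mul_assoc]
  refine mul_le_mul_of_nonneg_right ?_ (by positivity)
  refine (mul_le_of_le_one_left (norm_nonneg _) (norm_intCast_le_one _)).trans ?_
  refine (norm_phi_le (by lia) _).trans ?_
  have h1 := norm_nonneg (phi p 1 a)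
  push_cast
  have h2 := mul_nonneg h1 (n.cast_nonneg (α := ℝ))
  have h3 := mul_nonneg (s.cast_nonneg (α := ℝ)) (n.cast_nonneg (α := ℝ))
  linarith

theorem hasSum_phi_add_mul {s a D : ℕ} (hs : 1 ≤ s) (ha : ¬ p ∣ a) (hD : p ∣ D) (t : ℕ) :
    HasSum (fun n : ℕ => ((Ring.choose (-(s : ℤ)) n : ℤ) : ℚ_[p]) * phi p (s + n) a *
      (D : ℚ_[p]) ^ n * (t : ℚ_[p]) ^ n) (phi p s (a + D * t)) :=
  (hasSum_phi_add hs ha (hD.mul_right t)).congr_fun fun n => by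
    rw [Nat.cast_mul, mul_pow, mul_assoc]

theorem tendsto_classMean {s a D : ℕ} (hs : 1 ≤ s) (ha : ¬ p ∣ a) (hD : p ∣ D) :
    Tendsto (fun n : ℕ => (n : ℚ_[p])⁻¹ * ∑ t ∈ range n, phi p s (a + D * t)) toZero
      (𝓝 (classMean p s a D)) :=
  tendsto_mean_powerSeries (summable_phi_coeff hs a D hD) (hasSum_phi_add_mul hs ha hD)

theorem norm_mean_phi_le {s a D : ℕ} (hs : 2 ≤ s) (hD : p ∣ D) (n : ℕ) :
    ‖(n : ℚ_[p])⁻¹ * ∑ t ∈ range n, phi p s (a + D * t)‖ ≤ s * p := by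
  by_cases ha : p ∣ a
  · rw [sum_eq_zero fun t _ => phi_of_dvd (ha.add (hD.mul_right t)), mul_zero, norm_zero]
    positivity
  refine norm_mean_powerSeries_le (fun t => hasSum_phi_add_mul (by lia) ha hD t) (fun n => ?_) n
  have h1 := norm_intCast_le_one (p := p) (Ring.choose (1 - (s : ℤ)) n)
  have h2 : ‖(D : ℚ_[p])‖ ^ n ≤ 1 := pow_le_one₀ (norm_nonneg _) (norm_lt_one_of_dvd p hD).le
  have h3 := norm_phi_le_of_two_le (p := p) hs a
  rw [choose_mul_phi hs ha, norm_mul, norm_mul, norm_mul, norm_inv, norm_pow, norm_pow,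
    norm_eq_one_of_not_dvd p ha, one_pow, inv_one, mul_one, mul_assoc]
  exact (mul_le_mul h3 (mul_le_one₀ h1 (by positivity) h2) (by positivity) (by positivity)).trans
    (by rw [mul_one])

theorem norm_algebraMap_padic (x : ℚ_[p]) : ‖algebraMap ℚ_[p] ℂ_[p] x‖ = ‖x‖ := norm_algebraMap' _ x

theorem continuous_algebraMap_padic : Continuous (algebraMap ℚ_[p] ℂ_[p]) :=
  continuous_algebraMap _ _

theorem algebraMap_mean (g : ℕ → ℚ_[p]) (c : ℂ_[p]) (n : ℕ) :
    (n : ℂ_[p])⁻¹ * ∑ t ∈ range n, c * algebraMap ℚ_[p] ℂ_[p] (g t) =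
      c * algebraMap ℚ_[p] ℂ_[p] ((n : ℚ_[p])⁻¹ * ∑ t ∈ range n, g t) := by
  rw [← mul_sum, map_mul, map_inv₀, map_natCast, map_sum, mul_left_comm]

/-- A periodic weight turns the average of `phi s` into a finite combination of class averages. -/
theorem hasMean_phi {D s : ℕ} (hD0 : 0 < D) (hD : p ∣ D) (hs : 1 ≤ s) {w : ℕ → ℂ_[p]}
    (hw : ∀ a t, w (a + D * t) = w a) :
    HasMean (fun k => w k * algebraMap ℚ_[p] ℂ_[p] (phi p s k))
      ((D : ℂ_[p])⁻¹ * ∑ a ∈ Icc 1 D with a.Coprime p,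
        w a * algebraMap ℚ_[p] ℂ_[p] (classMean p s a D)) := by
  rw [sum_filter]
  refine HasMean.of_classes hD0 fun a _ => ?_
  simp_rw [hw, algebraMap_mean]
  by_cases ha : p ∣ a
  · have h1 : ¬ a.Coprime p := fun h => (Nat.Prime.coprime_iff_not_dvd Fact.out).1 h.symm ha
    simp [h1, phi_of_dvd (ha.add (hD.mul_right _))]
  · have h1 : a.Coprime p := ((Nat.Prime.coprime_iff_not_dvd Fact.out).2 ha).symm
    rw [if_pos h1]
    exact ((continuous_algebraMap_padic.tendsto _).comp (tendsto_classMean hs ha hD)).const_mul _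

theorem norm_sum_phi_le {D s X : ℕ} (hD : p ∣ D) (hs : 2 ≤ s) (hX : D ∣ X)
    {w : ℕ → ℂ_[p]} (hw : ∀ a t, w (a + D * t) = w a) (hw1 : ∀ a, ‖w a‖ ≤ 1) :
    ‖(X : ℂ_[p])⁻¹ * ∑ k ∈ Icc 1 X, w k * algebraMap ℚ_[p] ℂ_[p] (phi p s k)‖ ≤
      ‖(D : ℂ_[p])⁻¹‖ * (s * p) := by
  obtain ⟨n, rfl⟩ := hX
  rw [sum_Icc_one_mul, Nat.cast_mul, mul_inv, mul_assoc, mul_sum, norm_mul]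
  refine mul_le_mul_of_nonneg_left ?_ (norm_nonneg _)
  refine IsUltrametricDist.norm_sum_le_of_forall_le_of_nonneg (by positivity) fun a _ => ?_
  simp_rw [hw, algebraMap_mean]
  rw [norm_mul, norm_algebraMap_padic]
  exact (mul_le_of_le_one_left (norm_nonneg _) (hw1 a)).trans (norm_mean_phi_le hs hD n)

theorem HasMean.norm_phi_le {D s : ℕ} (hD0 : 0 < D) (hD : p ∣ D) (hs : 2 ≤ s)
    {w : ℕ → ℂ_[p]} (hw : ∀ a t, w (a + D * t) = w a) (hw1 : ∀ a, ‖w a‖ ≤ 1) {L : ℂ_[p]}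
    (hL : HasMean (fun k => w k * algebraMap ℚ_[p] ℂ_[p] (phi p s k)) L) :
    ‖L‖ ≤ ‖(D : ℂ_[p])⁻¹‖ * (s * p) :=
  le_of_tendsto hL.norm ((eventually_toZero_dvd hD0).mono fun _ h =>
    norm_sum_phi_le hD hs h.2 hw hw1)

/-! ### The values of the `p`-adic `L`-functions as averages -/

theorem coprime_iff_not_dvd {a : ℕ} : a.Coprime p ↔ ¬ p ∣ a := by
  rw [Nat.coprime_comm, Nat.Prime.coprime_iff_not_dvd Fact.out]

theorem norm_teich {a : ℕ} (ha : ¬ p ∣ a) : ‖((teich p (a : ZMod p) : ℤ_[p]) : ℚ_[p])‖ = 1 := by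
  have h := teich_pow p (a : ZMod p) (by rwa [Ne, ZMod.natCast_eq_zero_iff])
  have hp : p - 1 ≠ 0 := Nat.sub_ne_zero_of_lt (Fact.out : p.Prime).one_lt
  have h2 := congrArg norm h
  rw [norm_pow, norm_one] at h2
  exact (pow_eq_one_iff_of_nonneg (norm_nonneg _) hp).1 h2

theorem norm_angle_sub_one_lt {a : ℕ} (ha : ¬ p ∣ a) : ‖angle p a - 1‖ < 1 := by
  have h1 := norm_teich ha
  have h0 : ((teich p (a : ZMod p) : ℤ_[p]) : ℚ_[p]) ≠ 0 := norm_ne_zero_iff.1 (by rw [h1]; simp)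
  have h2 : ((a : ℤ_[p]) - teich p (a : ZMod p)) ∈
      RingHom.ker (PadicInt.toZMod : ℤ_[p] →+* ZMod p) := by
    rw [RingHom.mem_ker, map_sub, map_natCast, toZMod_teich, sub_self]
  rw [PadicInt.ker_toZMod, IsLocalRing.mem_maximalIdeal, PadicInt.mem_nonunits] at h2
  have h3 : angle p a - 1 = ((teich p (a : ZMod p) : ℤ_[p]) : ℚ_[p])⁻¹ *
      (((a : ℤ_[p]) - teich p (a : ZMod p) : ℤ_[p]) : ℚ_[p]) := by
    rw [angle]
    push_cast
    field_simp
  rw [h3, norm_mul, norm_inv, h1, inv_one, one_mul]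
  exact h2

theorem padicLog_angle {a : ℕ} (ha : ¬ p ∣ a) : padicLog p (angle p a) = logUnit p a := by
  have h1 := norm_angle_sub_one_lt ha
  have h2 : angle p a ^ (p - 1) = (a : ℚ_[p]) ^ (p - 1) := by
    have h := congrArg (fun x : ℤ_[p] => (x : ℚ_[p]))
      (teich_pow p (a : ZMod p) (by rwa [Ne, ZMod.natCast_eq_zero_iff]))
    push_cast at h
    rw [angle, mul_pow, inv_pow, h, inv_one, one_mul]
  rw [logUnit, ← h2, padicLog_pow h1, Nat.cast_sub (Fact.out : p.Prime).one_lt.le, Nat.cast_one,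
    mul_div_cancel_left₀ _ p_sub_one_ne_zero]

theorem anglePow_eq_binom (a : ℕ) (t : ℤ_[p]) : anglePow p a t = binom (angle p a - 1) t := rfl

theorem norm_bernoulliSeries_coeff_le {a D : ℕ} (ha : ¬ p ∣ a) (n : ℕ) :
    ‖((bernoulli n : ℚ) : ℚ_[p]) * ((D : ℚ_[p]) / (a : ℚ_[p])) ^ n‖ ≤ p * ‖(D : ℚ_[p])‖ ^ n := by
  rw [norm_mul, norm_pow, norm_div, norm_eq_one_of_not_dvd p ha, div_one]
  exact mul_le_mul_of_nonneg_right (norm_bernoulli_le p n) (by positivity)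

theorem bernoulliSeries_eq (D a : ℕ) (s : ℤ_[p]) :
    bernoulliSeries p D a s = ∑' n : ℕ, ((Ring.choose (1 - s) n : ℤ_[p]) : ℚ_[p]) *
      (((bernoulli n : ℚ) : ℚ_[p]) * ((D : ℚ_[p]) / (a : ℚ_[p])) ^ n) :=
  tsum_congr fun n => by rw [mul_assoc]

theorem one_sub_natCast (s : ℕ) : (1 : ℤ_[p]) - s = ((1 - (s : ℤ) : ℤ) : ℤ_[p]) := by push_cast; rfl

theorem classMean_eq_bernoulliSeries {s a D : ℕ} (hs : 2 ≤ s) (ha : ¬ p ∣ a) :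
    classMean p s a D = phi p s a * bernoulliSeries p D a s := by
  rw [bernoulliSeries_eq, ← tsum_mul_left, classMean]
  refine tsum_congr fun n => ?_
  rw [choose_mul_phi hs ha, one_sub_natCast, choose_intCast, div_pow]
  ring

/-- The twist by `ω ^ (1 - s)` cancels the Teichmüller factor of `⟨a⟩ ^ (1 - s)`; what is left is
`a ^ (1 - s)`. -/
theorem teich_zpow_mul_anglePow {s a : ℕ} (hs : 2 ≤ s) (ha : ¬ p ∣ a) :
    ((teich p (a : ZMod p) : ℤ_[p]) : ℚ_[p]) ^ (1 - (s : ℤ)) * anglePow p a (1 - s) =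
      ((s : ℚ_[p]) - 1) * phi p s a := by
  have h1 := norm_teich ha
  have h0 : ((teich p (a : ZMod p) : ℤ_[p]) : ℚ_[p]) ≠ 0 := norm_ne_zero_iff.1 (by rw [h1]; simp)
  have hs1 : (s : ℚ_[p]) - 1 ≠ 0 := by
    rw [sub_ne_zero]; exact_mod_cast (by lia : s ≠ 1)
  rw [anglePow_eq_binom, one_sub_natCast, binom_intCast (norm_angle_sub_one_lt ha),
    add_sub_cancel, ← mul_zpow, phi_of_ne_one (by lia) ha, mul_div_cancel₀ _ hs1, angle,
    mul_inv_cancel_left₀ h0]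

/-- Each summand of the explicit formula is `1 - u * classMean p 1 a D + o(u)` for `u = 1 - s → 0`.
For a nontrivial character the constant terms `1` cancel in the sum over `a`. -/
theorem tendsto_class_slope {a D : ℕ} (ha : ¬ p ∣ a) (hD : p ∣ D) :
    Tendsto (fun u : ℤ_[p] => (anglePow p a u * bernoulliSeries p D a (1 - u) - 1) / u) (𝓝[≠] 0)
      (𝓝 (-classMean p 1 a D)) := by
  have h1 := tendsto_binom_slope (norm_angle_sub_one_lt ha)
  rw [add_sub_cancel, padicLog_angle ha] at h1
  have h2 := tendsto_binomialSeries_slope (norm_nonneg (D : ℚ_[p])) (norm_lt_one_of_dvd p hD)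
    (norm_bernoulliSeries_coeff_le (D := D) ha)
  simp only [bernoulli_zero, Rat.cast_one, pow_zero, mul_one] at h2
  have hu : Tendsto (fun u : ℤ_[p] => (u : ℚ_[p])) (𝓝[≠] 0) (𝓝 0) := by
    have := (continuous_subtype_val (p := fun x : ℚ_[p] => ‖x‖ ≤ 1)).tendsto (0 : ℤ_[p])
    exact this.mono_left nhdsWithin_le_nhds
  have h3 := (h1.mul (hu.mul h2)).add (h1.add h2)
  have h4 : -classMean p 1 a D = logUnit p a + ∑' n : ℕ, (-1) ^ n * (((bernoulli (n + 1) : ℚ) :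
      ℚ_[p]) * ((D : ℚ_[p]) / (a : ℚ_[p])) ^ (n + 1)) / ((n : ℚ_[p]) + 1) := by
    have hc : Summable fun n : ℕ => ((Ring.choose (-((1 : ℕ) : ℤ)) n : ℤ) : ℚ_[p]) *
        phi p (1 + n) a * (D : ℚ_[p]) ^ n * ((bernoulli n : ℚ) : ℚ_[p]) := by
      refine Summable.of_norm_bounded ((summable_phi_coeff le_rfl a D hD).mul_right (p : ℝ))
        fun n => ?_
      rw [norm_mul]
      exact mul_le_mul_of_nonneg_left (norm_bernoulli_le p n) (norm_nonneg _)
    rw [classMean, hc.tsum_eq_zero_add, neg_add, ← tsum_neg]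
    congr 1
    · simp [phi_one ha]
    · refine tsum_congr fun n => ?_
      rw [choose_mul_phi_one ha, div_pow]
      ring
  rw [h4]
  simp only [zero_mul, mul_zero, zero_add] at h3
  refine h3.congr' ?_
  filter_upwards [self_mem_nhdsWithin] with u hu
  have hu0 : (u : ℚ_[p]) ≠ 0 := by
    intro h; exact hu (by simpa using h)
  rw [anglePow_eq_binom, bernoulliSeries_eq, sub_sub_cancel]
  field_simp
  ring

/-! ### The primitive character inducing `ψ ω ^ j` -/

theorem omega_zpow_apply {a : ℕ} (ha : ¬ p ∣ a) (j : ℤ) :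
    (omega p ^ j) (a : ZMod p) =
      algebraMap ℚ_[p] ℂ_[p] (((teich p (a : ZMod p) : ℤ_[p]) : ℚ_[p]) ^ j) := by
  have hu : IsUnit (a : ZMod p) := by rwa [isUnit_iff_ne_zero, Ne, ZMod.natCast_eq_zero_iff]
  have h1 : ∀ n : ℕ, (omega p ^ n) (a : ZMod p) =
      algebraMap ℚ_[p] ℂ_[p] (((teich p (a : ZMod p) : ℤ_[p]) : ℚ_[p]) ^ n) := by
    intro n
    obtain ⟨v, hv⟩ := hu
    rw [← hv, MulChar.pow_apply_coe, map_pow]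
    rfl
  rcases j with n | n
  · simpa using h1 n
  · rw [zpow_negSucc, zpow_negSucc, MulChar.inv_apply_eq_inv', h1, map_inv₀]

section Primitive

variable {f : ℕ} {ψ : DirichletCharacter ℂ_[p] f}

/-- Since `η` has level prime to `f`, multiplying by it does not lower the conductor of `ψ`. -/
theorem level_dvd_conductor_mul (hf : 0 < f) (hfp : f.Coprime p) (hψ : ψ.IsPrimitive)
    (η : DirichletCharacter ℂ_[p] p) : f ∣ (ψ.mul η).conductor := by
  have : NeZero f := ⟨hf.ne'⟩
  have hp := (Fact.out : p.Prime).pos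
  have : NeZero (Nat.lcm f p) := ⟨(Nat.lcm_pos hf hp).ne'⟩
  have h1 : DirichletCharacter.changeLevel (Nat.dvd_lcm_left f p) ψ =
      ψ.mul η * (DirichletCharacter.changeLevel (Nat.dvd_lcm_right f p) η)⁻¹ := by
    rw [DirichletCharacter.mul, mul_inv_cancel_right]
  have h2 := DirichletCharacter.conductor_mul_dvd_lcm_conductor (ψ.mul η)
    (DirichletCharacter.changeLevel (Nat.dvd_lcm_right f p) η)⁻¹
  rw [← h1, DirichletCharacter.conductor_changeLevel, DirichletCharacter.conductor_inv,
    DirichletCharacter.conductor_changeLevel, hψ] at h2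
  exact (hfp.dvd_of_dvd_mul_right
    (h2.trans ((Nat.lcm_dvd_mul _ _).trans (mul_dvd_mul_left _ η.conductor_dvd_level))))

theorem primitiveCharacter_mul_apply (hf : 0 < f) (hfp : f.Coprime p) (hψ : ψ.IsPrimitive)
    (η : DirichletCharacter ℂ_[p] p) {a : ℕ} (ha : ¬ p ∣ a) :
    (ψ.mul η).primitiveCharacter (a : ZMod _) = ψ (a : ZMod f) * η (a : ZMod p) := by
  have hap : a.Coprime p := coprime_iff_not_dvd.2 ha
  by_cases haf : a.Coprime f
  · have h1 : IsCoprime (a : ℤ) (Nat.lcm f p) := by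
      rw [Nat.isCoprime_iff_coprime]
      exact (haf.mul_right hap).coprime_dvd_right (Nat.lcm_dvd_mul f p)
    have h2 := (ψ.mul η).primitiveCharacter_apply_of_isCoprime h1
    have h3 : ψ.mul η ((a : ℤ) : ZMod (Nat.lcm f p)) =
        ψ ((a : ℤ) : ZMod f) * η ((a : ℤ) : ZMod p) := by
      rw [DirichletCharacter.mul, MulChar.mul_apply,
        DirichletCharacter.changeLevel_eq_cast_of_dvd' _ _ h1,
        DirichletCharacter.changeLevel_eq_cast_of_dvd' _ _ h1]
    rw [h3] at h2
    simpa only [Int.cast_natCast] using h2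
  · have h1 : ¬ a.Coprime (ψ.mul η).conductor := fun h =>
      haf (h.coprime_dvd_right (level_dvd_conductor_mul hf hfp hψ η))
    have h2 : ψ (a : ZMod f) = 0 := MulChar.map_nonunit _ (by rwa [ZMod.isUnit_iff_coprime])
    rw [h2, zero_mul]
    exact MulChar.map_nonunit _ (by rwa [ZMod.isUnit_iff_coprime])

theorem sum_Icc_coprime_eq_zero (hf : 0 < f) (hψ : ψ ≠ 1) {C : ℕ}
    (hC : f ∣ C) : ∑ a ∈ Icc 1 (p * C) with a.Coprime p, ψ (a : ZMod f) = 0 := by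
  have hp := (Fact.out : p.Prime).pos
  obtain ⟨c, rfl⟩ := hC
  have h0 : ∀ n : ℕ, ∑ a ∈ Icc 1 (f * n), ψ (a : ZMod f) = 0 := by
    intro n
    rw [sum_Icc_one_mul]
    simp [← mul_sum, sum_Icc_zmod hf ψ hψ]
  have h1 : ∑ a ∈ Icc 1 (p * (f * c)), (if p ∣ a then ψ (a : ZMod f) else 0) =
      ∑ b ∈ Icc 1 (f * c), ψ (p : ZMod f) * ψ (b : ZMod f) := by
    rw [← sum_filter]
    symm
    refine sum_bij (fun b _ => p * b) (fun b hb => ?_) (fun b _ b' _ h => ?_) (fun a ha => ?_)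
      (fun b _ => ?_)
    · simp only [mem_Icc, mem_filter, dvd_mul_right, and_true] at hb ⊢
      exact ⟨Nat.mul_pos hp hb.1, Nat.mul_le_mul_left p hb.2⟩
    · exact Nat.eq_of_mul_eq_mul_left hp h
    · simp only [mem_Icc, mem_filter] at ha
      obtain ⟨⟨h1, h2⟩, b, rfl⟩ := ha
      exact ⟨b, mem_Icc.2 ⟨Nat.pos_of_mul_pos_left h1, Nat.le_of_mul_le_mul_left h2 hp⟩, rfl⟩
    · rw [Nat.cast_mul, map_mul]
  have h2 : ∑ a ∈ Icc 1 (p * (f * c)) with a.Coprime p, ψ (a : ZMod f) =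
      ∑ a ∈ Icc 1 (p * (f * c)), ψ (a : ZMod f) -
        ∑ a ∈ Icc 1 (p * (f * c)), (if p ∣ a then ψ (a : ZMod f) else 0) := by
    rw [← sum_sub_distrib, sum_filter]
    refine sum_congr rfl fun a _ => ?_
    simp only [coprime_iff_not_dvd]
    split_ifs <;> simp_all
  rw [h2, h1, ← mul_sum, h0, mul_left_comm, h0]
  simp

theorem periodic_char {D : ℕ} (hD : f ∣ D) (a t : ℕ) :
    ψ ((a + D * t : ℕ) : ZMod f) = ψ (a : ZMod f) := by
  have : (D : ZMod f) = 0 := (ZMod.natCast_eq_zero_iff D f).2 hD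
  simp [this]

theorem omega_angle_factor (hf : 0 < f) (hfp : f.Coprime p) (hψ : ψ.IsPrimitive) {s a : ℕ}
    (hs : 2 ≤ s) (ha : ¬ p ∣ a) (D : ℕ) :
    1 / (algebraMap ℚ_[p] ℂ_[p] (((s : ℤ_[p])) : ℚ_[p]) - 1) *
      ((ψ.mul (omega p ^ (1 - (s : ℤ)))).primitiveCharacter (a : ZMod _) *
        algebraMap ℚ_[p] ℂ_[p] (anglePow p a (1 - s) * bernoulliSeries p D a s)) =
      ψ (a : ZMod f) * algebraMap ℚ_[p] ℂ_[p] (classMean p s a D) := by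
  have hs1 : (s : ℂ_[p]) - 1 ≠ 0 := by
    rw [sub_ne_zero]; exact_mod_cast (by lia : s ≠ 1)
  have h := congrArg (algebraMap ℚ_[p] ℂ_[p]) (teich_zpow_mul_anglePow hs ha)
  rw [map_mul, map_mul, map_sub, map_natCast, map_one] at h
  rw [primitiveCharacter_mul_apply hf hfp hψ _ ha, omega_zpow_apply ha,
    classMean_eq_bernoulliSeries hs ha, map_mul, map_mul, PadicInt.coe_natCast, map_natCast]
  field_simp
  linear_combination (ψ (a : ZMod f) * algebraMap ℚ_[p] ℂ_[p] (bernoulliSeries p D a s)) * h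

theorem tendsto_padicLFormula_one (hf : 0 < f) (hfp : f.Coprime p) (hψ : ψ.IsPrimitive)
    (hψ1 : ψ ≠ 1) (η : DirichletCharacter ℂ_[p] p) (hη : η = 1) :
    Tendsto (padicLFormula p (ψ.mul η).primitiveCharacter) (𝓝[≠] 1)
      (𝓝 (((p * (ψ.mul η).conductor : ℕ) : ℂ_[p])⁻¹ *
        ∑ a ∈ Icc 1 (p * (ψ.mul η).conductor) with a.Coprime p, ψ (a : ZMod f) *
          algebraMap ℚ_[p] ℂ_[p] (classMean p 1 a (p * (ψ.mul η).conductor)))) := by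
  -- only the conductor `C` of `ψ.mul η` enters the formula; that it equals `f` is not needed
  set C := (ψ.mul η).conductor with hC
  have hfC : f ∣ C := level_dvd_conductor_mul hf hfp hψ η
  have hval : ∀ a : ℕ, a.Coprime p →
      (ψ.mul η).primitiveCharacter (a : ZMod _) = ψ (a : ZMod f) := by
    intro a ha
    have ha' := coprime_iff_not_dvd.1 ha
    rw [primitiveCharacter_mul_apply hf hfp hψ η ha', hη, MulChar.one_apply, mul_one]
    rwa [isUnit_iff_ne_zero, Ne, ZMod.natCast_eq_zero_iff]
  have h1 : Tendsto (fun s : ℤ_[p] => 1 - s) (𝓝[≠] 1) (𝓝[≠] 0) := by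
    refine tendsto_nhdsWithin_iff.2 ⟨?_, ?_⟩
    · have : Tendsto (fun s : ℤ_[p] => 1 - s) (𝓝 1) (𝓝 (1 - 1)) :=
        (continuous_const.sub continuous_id).tendsto 1
      rw [sub_self] at this
      exact this.mono_left nhdsWithin_le_nhds
    · filter_upwards [self_mem_nhdsWithin] with s hs
      exact sub_ne_zero.2 (Ne.symm hs)
  have h2 : Tendsto (fun s : ℤ_[p] => ((p * C : ℕ) : ℂ_[p])⁻¹ *
      ∑ a ∈ Icc 1 (p * C) with a.Coprime p, ψ (a : ZMod f) * -algebraMap ℚ_[p] ℂ_[p]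
        ((anglePow p a (1 - s) * bernoulliSeries p (p * C) a (1 - (1 - s)) - 1) /
          ((1 - s : ℤ_[p]) : ℚ_[p]))) (𝓝[≠] 1)
      (𝓝 (((p * C : ℕ) : ℂ_[p])⁻¹ * ∑ a ∈ Icc 1 (p * C) with a.Coprime p, ψ (a : ZMod f) *
          algebraMap ℚ_[p] ℂ_[p] (classMean p 1 a (p * C)))) := by
    refine (tendsto_finsetSum _ fun a ha => ?_).const_mul _
    have ha' : ¬ p ∣ a := coprime_iff_not_dvd.1 (mem_filter.1 ha).2
    have h3 := ((continuous_algebraMap_padic.tendsto _).comp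
      ((tendsto_class_slope ha' (dvd_mul_right p C)).comp h1)).neg
    rw [map_neg, neg_neg] at h3
    exact h3.const_mul _
  refine h2.congr' ?_
  filter_upwards [self_mem_nhdsWithin] with s hs
  have hs0 : (algebraMap ℚ_[p] ℂ_[p] (s : ℚ_[p]) - 1) ≠ 0 := by
    rw [sub_ne_zero, Ne, ← map_one (algebraMap ℚ_[p] ℂ_[p]),
      (algebraMap ℚ_[p] ℂ_[p]).injective.eq_iff]
    intro h
    have h' : s = 1 := PadicInt.ext (by rw [h, PadicInt.coe_one])
    exact hs h'
  have hs0' : (1 - algebraMap ℚ_[p] ℂ_[p] (s : ℚ_[p])) ≠ 0 := by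
    rw [← neg_sub]; exact neg_ne_zero.2 hs0
  rw [padicLFormula, mul_assoc, one_div]
  congr 1
  have h4 : ∑ a ∈ Icc 1 (p * C) with a.Coprime p,
      (ψ.mul η).primitiveCharacter (a : ZMod _) *
        algebraMap ℚ_[p] ℂ_[p] (anglePow p a (1 - s) * bernoulliSeries p (p * C) a s) =
      ∑ a ∈ Icc 1 (p * C) with a.Coprime p, ψ (a : ZMod f) *
        (algebraMap ℚ_[p] ℂ_[p] (anglePow p a (1 - s) * bernoulliSeries p (p * C) a s) - 1) := by
    simp_rw [mul_sub, sum_sub_distrib, mul_one]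
    rw [sum_Icc_coprime_eq_zero hf hψ1 hfC, sub_zero]
    exact sum_congr rfl fun a ha => by rw [hval a (mem_filter.1 ha).2]
  rw [h4, mul_sum]
  refine sum_congr rfl fun a _ => ?_
  rw [sub_sub_cancel, PadicInt.coe_sub, PadicInt.coe_one, map_div₀, map_sub, map_sub, map_one]
  field_simp
  ring

/-- The limit defining `padicL` at `1` is taken along a proper filter. -/
theorem neBot_nhdsNE_one : (𝓝[≠] (1 : ℤ_[p])).NeBot := by
  have h1 : Tendsto (fun N : ℕ => (p : ℤ_[p]) ^ N + 1) atTop (𝓝[≠] 1) := by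
    refine tendsto_nhdsWithin_iff.2 ⟨?_, Eventually.of_forall fun N => ?_⟩
    · have h := (tendsto_pow_atTop_nhds_zero_of_norm_lt_one (R := ℤ_[p]) (x := p)
        (PadicInt.norm_natCast_lt_one_iff.2 dvd_rfl)).add_const 1
      rwa [zero_add] at h
    · have h : (p : ℤ_[p]) ^ N ≠ 0 :=
        pow_ne_zero _ (by exact_mod_cast (Fact.out : p.Prime).ne_zero)
      simpa using h
  exact h1.neBot

/-- The values of the `p`-adic `L`-functions are averages of `ψ · phi s`. -/
theorem hasMean_LValue (hf : 0 < f) (hfp : f.Coprime p) (hψ : ψ.IsPrimitive) {s : ℕ}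
    (hs : 1 ≤ s) (hψs : s = 1 → ψ ≠ 1) :
    HasMean (fun k => ψ (k : ZMod f) * algebraMap ℚ_[p] ℂ_[p] (phi p s k)) (LValue p ψ s) := by
  set η := omega p ^ (1 - (s : ℤ)) with hη
  have hp := (Fact.out : p.Prime).pos
  have hlcm : NeZero (Nat.lcm f p) := ⟨(Nat.lcm_pos hf hp).ne'⟩
  have hC : 0 < (ψ.mul η).conductor := Nat.pos_of_ne_zero (DirichletCharacter.conductor_ne_zero _)
  have hfC : f ∣ (ψ.mul η).conductor := level_dvd_conductor_mul hf hfp hψ η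
  have h := hasMean_phi (Nat.mul_pos hp hC) (dvd_mul_right p _) hs
    (w := fun k => ψ (k : ZMod f)) (periodic_char (hfC.mul_left p))
  convert h using 1
  rcases hs.eq_or_lt with rfl | hs
  · rw [LValue, padicL, Nat.cast_one, if_pos rfl]
    have := neBot_nhdsNE_one (p := p)
    exact (tendsto_padicLFormula_one hf hfp hψ (hψs rfl) η (by simp [hη])).limUnder_eq
  · have hs1 : (s : ℤ_[p]) ≠ 1 := by exact_mod_cast hs.ne'
    rw [LValue, padicL, if_neg hs1, padicLFormula, mul_assoc, one_div, mul_sum]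
    congr 1
    refine sum_congr rfl fun a ha => ?_
    exact omega_angle_factor hf hfp hψ hs (coprime_iff_not_dvd.1 (mem_filter.1 ha).2) _

end Primitive

/-! ### Euler factors -/

section Sieve

variable {f : ℕ} {ψ : DirichletCharacter ℂ_[p] f}

open Classical in
/-- The character `ψ` made to vanish at the multiples of the elements of `T`. -/
noncomputable def sifted (ψ : DirichletCharacter ℂ_[p] f) (T : Finset ℕ) (k : ℕ) : ℂ_[p] :=
  if ∃ q ∈ T, q ∣ k then 0 else ψ (k : ZMod f)

theorem sifted_empty (k : ℕ) : sifted ψ ∅ k = ψ (k : ZMod f) := by simp [sifted]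

theorem sifted_insert (q : ℕ) (T : Finset ℕ) (k : ℕ) :
    sifted ψ (insert q T) k = if q ∣ k then 0 else sifted ψ T k := by
  simp only [sifted, mem_insert, exists_eq_or_imp]
  split_ifs <;> simp_all

theorem sifted_mul {q : ℕ} (hq : q.Prime) {T : Finset ℕ} (hT : ∀ l ∈ T, l.Prime) (hqT : q ∉ T)
    (k : ℕ) : sifted ψ T (q * k) = ψ (q : ZMod f) * sifted ψ T k := by
  have h : (∃ l ∈ T, l ∣ q * k) ↔ ∃ l ∈ T, l ∣ k := by
    refine exists_congr fun l => and_congr_right fun hl => ⟨fun h => ?_, fun h => h.mul_left q⟩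
    refine ((hT l hl).dvd_mul.1 h).resolve_left fun h' => hqT ?_
    rwa [← (Nat.prime_dvd_prime_iff_eq (hT l hl) hq).1 h']
  simp only [sifted, h]
  split_ifs <;> simp

/-- One step of the sieve, for a function `g` that is homogeneous under `k ↦ q k` up to a multiple
of `u`. -/
theorem hasMean_sifted_insert {q : ℕ} (hq : q.Prime) {T : Finset ℕ} (hT : ∀ l ∈ T, l.Prime)
    (hqT : q ∉ T) {g u : ℕ → ℂ_[p]} {α δ L P : ℂ_[p]} (hg : ∀ k, g (q * k) = α * g k + δ * u k)
    (hL : HasMean (fun k => sifted ψ T k * g k) L) (hP : HasMean (fun k => sifted ψ T k * u k) P) :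
    HasMean (fun k => sifted ψ (insert q T) k * g k)
      (L - (q : ℂ_[p])⁻¹ * (ψ (q : ZMod f) * (α * L + δ * P))) := by
  have h1 := ((hL.const_mul α).add (hP.const_mul δ)).const_mul (ψ (q : ZMod f))
  refine (hL.sieve hq.pos h1 fun j => ?_).congr fun k => ?_
  · rw [hg, sifted_mul hq hT hqT]; ring
  · rw [sifted_insert]; split_ifs <;> simp

theorem hasMean_sifted_unit {M : ℂ_[p]} (hM : HasMean (fun k => ψ (k : ZMod f)) M)
    (T : Finset ℕ) (hT : ∀ q ∈ T, q.Prime ∧ ¬ p ∣ q) :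
    HasMean (fun k => sifted ψ T k * if p ∣ k then 0 else 1)
      (M * (1 - ψ (p : ZMod f) / (p : ℂ_[p])) * ∏ q ∈ T, (1 - ψ (q : ZMod f) / (q : ℂ_[p]))) := by
  have hp : p.Prime := Fact.out
  induction T using Finset.induction_on with
  | empty =>
    have h := hM.sieve hp.pos (hM.const_mul (ψ (p : ZMod f))) fun j => by
      rw [Nat.cast_mul, map_mul]
    convert h using 1
    · funext k
      rw [sifted_empty]
      split_ifs <;> simp
    · rw [prod_empty]; ring
  | insert q T hqT ih =>
    have hq := hT q (mem_insert_self q T)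
    have ih' := ih fun l hl => hT l (mem_insert_of_mem hl)
    have h := hasMean_sifted_insert (α := 1) (δ := 0) hq.1
      (fun l hl => (hT l (mem_insert_of_mem hl)).1) hqT (fun k => by
        have : p ∣ q * k ↔ p ∣ k := by simp [hp.dvd_mul, hq.2]
        simp [this]) ih' ih'
    convert h using 1
    rw [prod_insert hqT]
    ring

theorem phi_mul_algebraMap {s q : ℕ} (hq : ¬ p ∣ q) (k : ℕ) :
    algebraMap ℚ_[p] ℂ_[p] (phi p s (q * k)) =
      (q : ℂ_[p]) ^ (1 - (s : ℤ)) * algebraMap ℚ_[p] ℂ_[p] (phi p s k) +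
        algebraMap ℚ_[p] ℂ_[p] (phiDefect p s q) * (if p ∣ k then 0 else 1) := by
  rw [phi_mul hq, map_add, map_mul, map_mul, map_zpow₀, map_natCast]
  split_ifs <;> simp

/-- Sieving by a prime `q` multiplies the average of `ψ · phi s` by an Euler factor, unless `ψ` is
trivial and `s = 1`. -/
theorem hasMean_sifted_phi (hf : 0 < f) {s : ℕ} (hψs : s = 1 → ψ ≠ 1) {L : ℂ_[p]}
    (hL : HasMean (fun k => ψ (k : ZMod f) * algebraMap ℚ_[p] ℂ_[p] (phi p s k)) L)
    (T : Finset ℕ) (hT : ∀ q ∈ T, q.Prime ∧ ¬ p ∣ q) :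
    HasMean (fun k => sifted ψ T k * algebraMap ℚ_[p] ℂ_[p] (phi p s k))
      ((∏ q ∈ T, (1 - ψ (q : ZMod f) * (q : ℂ_[p]) ^ (-(s : ℤ)))) * L) := by
  induction T using Finset.induction_on with
  | empty => simpa [sifted_empty] using hL
  | insert q T hqT ih =>
    have hq := hT q (mem_insert_self q T)
    have hq0 : (q : ℂ_[p]) ≠ 0 := by exact_mod_cast hq.1.ne_zero
    have hT' : ∀ l ∈ T, l.Prime ∧ ¬ p ∣ l := fun l hl => hT l (mem_insert_of_mem hl)
    have hT'' : ∀ l ∈ T, l.Prime := fun l hl => (hT' l hl).1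
    have key : HasMean (fun k => sifted ψ (insert q T) k * algebraMap ℚ_[p] ℂ_[p] (phi p s k))
        ((∏ q ∈ T, (1 - ψ (q : ZMod f) * (q : ℂ_[p]) ^ (-(s : ℤ)))) * L - (q : ℂ_[p])⁻¹ *
          (ψ (q : ZMod f) * ((q : ℂ_[p]) ^ (1 - (s : ℤ)) *
            ((∏ q ∈ T, (1 - ψ (q : ZMod f) * (q : ℂ_[p]) ^ (-(s : ℤ)))) * L) + 0))) := by
      by_cases hs : s = 1
      · have hP := hasMean_sifted_unit (hasMean_char hf (hψs hs)) T hT'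
        rw [zero_mul, zero_mul] at hP
        have h := hasMean_sifted_insert hq.1 hT'' hqT (phi_mul_algebraMap hq.2) (ih hT') hP
        rwa [mul_zero] at h
      · have hα : ∀ k : ℕ, algebraMap ℚ_[p] ℂ_[p] (phi p s (q * k)) =
            (q : ℂ_[p]) ^ (1 - (s : ℤ)) * algebraMap ℚ_[p] ℂ_[p] (phi p s k) +
              0 * algebraMap ℚ_[p] ℂ_[p] (phi p s k) := fun k => by
          rw [phi_mul_algebraMap hq.2]; simp [phiDefect, hs]
        have h := hasMean_sifted_insert hq.1 hT'' hqT hα (ih hT') (ih hT')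
        rwa [zero_mul] at h
    convert key using 1
    rw [prod_insert hqT, sub_eq_add_neg 1 (s : ℤ), zpow_add₀ hq0, zpow_one]
    field_simp
    ring

/-- For the trivial character at `s = 1`, sieving produces in addition the logarithms of the primes
that are removed. -/
theorem hasMean_sifted_one_phi_one {A : ℂ_[p]}
    (hA : HasMean (fun k => algebraMap ℚ_[p] ℂ_[p] (phi p 1 k)) A)
    (T : Finset ℕ) (hT : ∀ q ∈ T, q.Prime ∧ ¬ p ∣ q) :
    HasMean (fun k => sifted (1 : DirichletCharacter ℂ_[p] 1) T k *
        algebraMap ℚ_[p] ℂ_[p] (phi p 1 k))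
      ((∏ q ∈ T, (1 - 1 / (q : ℂ_[p]))) * (A + (1 - 1 / (p : ℂ_[p])) *
        ∑ q ∈ T, algebraMap ℚ_[p] ℂ_[p] (logUnit p q) / ((q : ℂ_[p]) - 1))) := by
  have h1 : ∀ k : ℕ, (1 : DirichletCharacter ℂ_[p] 1) (k : ZMod 1) = 1 := fun k =>
    MulChar.one_apply (isUnit_of_subsingleton _)
  induction T using Finset.induction_on with
  | empty => simpa [sifted_empty, h1] using hA
  | insert q T hqT ih =>
    have hq := hT q (mem_insert_self q T)
    have hq0 : (q : ℂ_[p]) ≠ 0 := by exact_mod_cast hq.1.ne_zero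
    have hq1 : (q : ℂ_[p]) - 1 ≠ 0 := by rw [sub_ne_zero]; exact_mod_cast hq.1.one_lt.ne'
    have hT' : ∀ l ∈ T, l.Prime ∧ ¬ p ∣ l := fun l hl => hT l (mem_insert_of_mem hl)
    have hP := hasMean_sifted_unit (hasMean_one.congr fun k => (h1 k).symm) T hT'
    have h := hasMean_sifted_insert hq.1 (fun l hl => (hT' l hl).1) hqT (phi_mul_algebraMap hq.2)
      (ih hT') hP
    convert h using 1
    rw [prod_insert hqT, sum_insert hqT]
    simp only [h1, one_mul, phiDefect, if_true, map_neg, Nat.cast_one, sub_self, zpow_zero]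
    field_simp
    ring

end Sieve

/-! ### Orthogonality of primitive characters -/

/-- Sifting a character of level `f` by the primes dividing `r / f` induces it to level `r`. -/
theorem sifted_eq_changeLevel {f r : ℕ} (hr : 0 < r) (hfr : f ∣ r)
    (ψ : DirichletCharacter ℂ_[p] f) (k : ℕ) :
    sifted ψ (r / f).primeFactors k =
      DirichletCharacter.changeLevel hfr ψ (k : ZMod r) := by
  have hf0 : r / f ≠ 0 := (Nat.div_pos (Nat.le_of_dvd hr hfr) (Nat.pos_of_dvd_of_pos hfr hr)).ne'
  by_cases hk : k.Coprime r
  · have h1 : ¬ ∃ q ∈ (r / f).primeFactors, q ∣ k := by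
      rintro ⟨q, hq, hqk⟩
      have hqr := (Nat.dvd_of_mem_primeFactors hq).trans (Nat.div_dvd_of_dvd hfr)
      exact (Nat.prime_of_mem_primeFactors hq).one_lt.ne'
        (Nat.eq_one_of_dvd_coprimes hk hqk hqr)
    have h2 := DirichletCharacter.changeLevel_eq_cast_of_dvd' ψ hfr
      (Nat.isCoprime_iff_coprime.2 hk)
    rw [sifted, if_neg h1]
    simpa only [Int.cast_natCast] using h2.symm
  · rw [MulChar.map_nonunit _ (by rwa [ZMod.isUnit_iff_coprime]), sifted]
    split_ifs with h
    · rfl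
    · refine MulChar.map_nonunit _ ?_
      rw [ZMod.isUnit_iff_coprime]
      intro hkf
      obtain ⟨q, hq, hqk, hqr⟩ := Nat.Prime.not_coprime_iff_dvd.1 hk
      have hqf : ¬ q ∣ f := fun h' => hq.one_lt.ne' (Nat.eq_one_of_dvd_coprimes hkf hqk h')
      rw [← Nat.div_mul_cancel hfr] at hqr
      exact h ⟨q, Nat.mem_primeFactors.2 ⟨hq, (hq.dvd_mul.1 hqr).resolve_right hqf, hf0⟩, hqk⟩

theorem mem_primitiveChars {f : ℕ} {ψ : DirichletCharacter ℂ_[p] f} :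
    ψ ∈ primitiveChars p f ↔ ψ.IsPrimitive := by
  classical
  simp [primitiveChars]

/-- The primitive characters of conductor dividing `r`, sifted by the primes dividing `r`, are the
characters modulo `r`; hence they satisfy the orthogonality relation. -/
theorem sum_primitiveChars_mul_sifted {r : ℕ} (hr : 0 < r) {b : ℤ} (hb : IsCoprime b r) (k : ℕ) :
    ∑ f ∈ r.divisors, ∑ ψ ∈ primitiveChars p f,
      ψ⁻¹ (b : ZMod f) * sifted ψ (r / f).primeFactors k =
        if (b : ZMod r) = k then (r.totient : ℂ_[p]) else 0 := by
  have : NeZero r := ⟨hr.ne'⟩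
  have hbu : IsUnit (b : ZMod r) := (ZMod.coe_int_isUnit_iff_isCoprime b r).2 hb.symm
  rw [← DirichletCharacter.sum_char_inv_mul_char_eq ℂ_[p] hbu, sum_sigma']
  refine sum_bij (fun x hx => DirichletCharacter.changeLevel
    (Nat.dvd_of_mem_divisors (mem_sigma.1 hx).1) x.2) (fun _ _ => mem_univ _) ?_ ?_ ?_
  · rintro ⟨f, ψ⟩ hx ⟨f', ψ'⟩ hx' h
    have h1 : f = f' := by
      dsimp only at h
      rw [← show ψ.conductor = f from mem_primitiveChars.1 (mem_sigma.1 hx).2,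
        ← show ψ'.conductor = f' from mem_primitiveChars.1 (mem_sigma.1 hx').2]
      have := congrArg DirichletCharacter.conductor h
      rwa [DirichletCharacter.conductor_changeLevel,
        DirichletCharacter.conductor_changeLevel] at this
    subst h1
    exact congrArg (Sigma.mk f) (DirichletCharacter.changeLevel_injective _ h)
  · intro χ _
    exact ⟨⟨χ.conductor, χ.primitiveCharacter⟩, mem_sigma.2
      ⟨Nat.mem_divisors.2 ⟨χ.conductor_dvd_level, hr.ne'⟩,
        mem_primitiveChars.2 χ.primitiveCharacter_isPrimitive⟩, χ.changeLevel_primitiveCharacter⟩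
  · rintro ⟨f, ψ⟩ hx
    have hfr := Nat.dvd_of_mem_divisors (mem_sigma.1 hx).1
    rw [sifted_eq_changeLevel hr hfr, MulChar.inv_apply_eq_inv',
      ← DirichletCharacter.changeLevel_eq_cast_of_dvd' ψ hfr hb]
    congr 1
    refine inv_eq_of_mul_eq_one_right ?_
    rw [← map_mul, ZMod.mul_inv_of_unit _ hbu, map_one]

/-! ### Shifts and Taylor expansions of averages -/

/-- Shifting the range of summation changes the average by the sum of the derivatives at `0` of
`X ↦ g (l + X)`. -/
theorem HasMean.shift {g : ℕ → ℂ_[p]} {L : ℂ_[p]} (hg : HasMean g L) (M : ℕ) {g' : ℕ → ℂ_[p]}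
    (hg' : ∀ l ∈ Icc 1 M,
      Tendsto (fun X : ℕ => (X : ℂ_[p])⁻¹ * (g (l + X) - g l)) toZero (𝓝 (g' l))) :
    HasMean (fun l => g (l + M)) (L + ∑ l ∈ Icc 1 M, g' l) := by
  refine (Tendsto.add hg (tendsto_finsetSum _ hg')).congr fun X => ?_
  rw [← mul_sum, ← mul_add, sum_sub_distrib]
  congr 1
  have h1 := sum_range_add (fun i => g (i + 1)) X M
  have h2 := sum_range_add (fun i => g (i + 1)) M X
  rw [add_comm M X, h1] at h2
  simp only [sum_Icc_one]
  have h3 : ∑ i ∈ range M, g (i + 1 + X) = ∑ i ∈ range M, g (X + i + 1) :=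
    sum_congr rfl fun i _ => by congr 1; ring
  have h4 : ∑ i ∈ range X, g (i + 1 + M) = ∑ i ∈ range X, g (M + i + 1) :=
    sum_congr rfl fun i _ => by congr 1; ring
  rw [h3, h4]
  linear_combination h2

theorem tendsto_phi_slope {m l : ℕ} (hm : 1 ≤ m) (hl : ¬ p ∣ l) :
    Tendsto (fun X : ℕ => (X : ℚ_[p])⁻¹ * (phi p m (l + X) - phi p m l)) toZero
      (𝓝 (-((l : ℚ_[p]) ^ m)⁻¹)) := by
  have hp := (Fact.out : p.Prime).pos
  have hm0 : (m : ℚ_[p]) ≠ 0 := by exact_mod_cast (by lia : m ≠ 0)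
  have hl0 := natCast_ne_zero_of_not_dvd hl
  have hp0 : (p : ℚ_[p]) ≠ 0 := by exact_mod_cast hp.ne'
  set c : ℕ → ℚ_[p] := fun n => ((Ring.choose (-(m : ℤ)) n : ℤ) : ℚ_[p]) * phi p (m + n) l with hc
  have h1 : Tendsto (fun X : ℕ => ∑' n : ℕ, c (n + 1) * (X : ℚ_[p]) ^ n) toZero
      (𝓝 (∑' n : ℕ, c (n + 1) * (0 : ℚ_[p]) ^ n)) := by
    refine tendsto_tsum_of_dominated_convergence
      (bound := fun n => ‖c (n + 1) * (p : ℚ_[p]) ^ (n + 1)‖ * ‖(p : ℚ_[p])‖⁻¹)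
      (((summable_nat_add_iff 1).2 (summable_phi_coeff hm l p dvd_rfl)).mul_right _)
      (fun n => ((tendsto_natCast_toZero p).pow n).const_mul _) ?_
    filter_upwards [eventually_toZero_dvd hp] with X ⟨_, y, hX⟩ n
    have h2 : ‖(X : ℚ_[p])‖ ≤ ‖(p : ℚ_[p])‖ := by
      rw [hX, Nat.cast_mul, norm_mul]
      exact mul_le_of_le_one_right (norm_nonneg _) (norm_natCast_le_one p y)
    have h3 : ‖(p : ℚ_[p])‖ ≠ 0 := norm_ne_zero_iff.2 hp0
    rw [norm_mul (c (n + 1)), norm_mul (c (n + 1)), norm_pow, norm_pow, pow_succ, mul_assoc,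
      mul_assoc, mul_inv_cancel₀ h3, mul_one]
    exact mul_le_mul_of_nonneg_left (pow_le_pow_left₀ (norm_nonneg _) h2 n) (norm_nonneg _)
  have h2 : ∑' n : ℕ, c (n + 1) * (0 : ℚ_[p]) ^ n = -((l : ℚ_[p]) ^ m)⁻¹ := by
    rw [tsum_eq_single 0 (fun n hn => by rw [zero_pow hn, mul_zero])]
    simp only [hc, zero_add, pow_zero, mul_one]
    rw [Ring.choose_one_right, phi_of_ne_one (by lia) hl,
      show (1 - ((m + 1 : ℕ) : ℤ)) = -(m : ℤ) by push_cast; ring, zpow_neg, zpow_natCast]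
    push_cast
    rw [add_sub_cancel_right]
    field_simp
  rw [h2] at h1
  refine h1.congr' ?_
  filter_upwards [eventually_toZero_dvd hp] with X ⟨hX0, hX⟩
  have hX0' : (X : ℚ_[p]) ≠ 0 := by exact_mod_cast hX0.ne'
  have h3 := (hasSum_nat_add_iff' 1).2 (hasSum_phi_add hm hl hX)
  simp only [sum_range_one, Ring.choose_zero_right, add_zero, pow_zero, Int.cast_one, one_mul,
    mul_one] at h3
  rw [← h3.tsum_eq, ← tsum_mul_left]
  refine tsum_congr fun n => ?_
  rw [pow_succ]
  field_simp
  rfl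

/-- The shift by `M` of the average of `phi m` produces the sum of `l ^ (-m)` over `l ≤ M`. -/
theorem hasMean_phi_shift {m : ℕ} (hm : 1 ≤ m) {A : ℂ_[p]}
    (hA : HasMean (fun k => algebraMap ℚ_[p] ℂ_[p] (phi p m k)) A) (M : ℕ) :
    HasMean (fun l => algebraMap ℚ_[p] ℂ_[p] (phi p m (l + M)))
      (A - ∑ l ∈ Icc 1 M with l.Coprime p, 1 / (l : ℂ_[p]) ^ m) := by
  have h := hA.shift M (g' := fun l => -(if l.Coprime p then 1 / (l : ℂ_[p]) ^ m else 0))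
    fun l _ => by
    by_cases hl : p ∣ l
    · have : ¬ l.Coprime p := fun h => coprime_iff_not_dvd.1 h hl
      rw [if_neg this, neg_zero]
      refine Tendsto.congr' ?_ tendsto_const_nhds
      filter_upwards [eventually_toZero_dvd (Fact.out : p.Prime).pos] with X ⟨_, hX⟩
      rw [phi_of_dvd hl, phi_of_dvd (hl.add hX)]
      simp
    · rw [if_pos (coprime_iff_not_dvd.2 hl)]
      have h2 := (continuous_algebraMap_padic.tendsto _).comp (tendsto_phi_slope hm hl)
      simpa [Function.comp_def] using h2
  rw [sum_neg_distrib, ← sub_eq_add_neg, ← sum_filter] at h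
  exact h

theorem hasMean_unit :
    HasMean (fun k => if p ∣ k then 0 else (1 : ℂ_[p])) (1 - 1 / (p : ℂ_[p])) := by
  have h := (hasMean_one (p := p)).sieve (Fact.out : p.Prime).pos hasMean_one fun _ => rfl
  simpa using h

theorem hasMean_unit_shift (M : ℕ) :
    HasMean (fun k => if p ∣ k + M then 0 else (1 : ℂ_[p])) (1 - 1 / (p : ℂ_[p])) := by
  have h := (hasMean_unit (p := p)).shift M (g' := fun _ => 0) fun l _ => by
    refine Tendsto.congr' ?_ tendsto_const_nhds
    filter_upwards [eventually_toZero_dvd (Fact.out : p.Prime).pos] with X ⟨_, hX⟩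
    have : p ∣ l + X ↔ p ∣ l := (Nat.dvd_add_left hX)
    simp [this]
  simpa using h

theorem hasSum_mean_phi_add {m y : ℕ} (hm : 1 ≤ m) (hy : p ∣ y) (w : ℕ → ℂ_[p]) (X : ℕ) :
    HasSum (fun n : ℕ => ((Ring.choose (-(m : ℤ)) n : ℤ) : ℂ_[p]) * (y : ℂ_[p]) ^ n *
      ((X : ℂ_[p])⁻¹ * ∑ k ∈ Icc 1 X, w k * algebraMap ℚ_[p] ℂ_[p] (phi p (m + n) k)))
      ((X : ℂ_[p])⁻¹ * ∑ k ∈ Icc 1 X, w k * algebraMap ℚ_[p] ℂ_[p] (phi p m (k + y))) := by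
  have h4 : ∀ k ∈ Icc 1 X, HasSum (fun n : ℕ => w k * (((Ring.choose (-(m : ℤ)) n : ℤ) : ℂ_[p]) *
      algebraMap ℚ_[p] ℂ_[p] (phi p (m + n) k) * (y : ℂ_[p]) ^ n))
      (w k * algebraMap ℚ_[p] ℂ_[p] (phi p m (k + y))) := by
    intro k _
    by_cases hk : p ∣ k
    · rw [phi_of_dvd (hk.add hy), map_zero, mul_zero]
      refine hasSum_zero.congr_fun fun n => ?_
      rw [phi_of_dvd hk, map_zero, mul_zero, zero_mul, mul_zero]
    · have h5 := (hasSum_phi_add hm hk hy).map (algebraMap ℚ_[p] ℂ_[p])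
        continuous_algebraMap_padic
      refine (h5.mul_left (w k)).congr_fun fun n => ?_
      rw [Function.comp, map_mul, map_mul, map_pow, map_intCast, map_natCast]
  refine ((hasSum_sum h4).mul_left _).congr_fun fun n => ?_
  rw [mul_sum, mul_sum, mul_sum]
  exact sum_congr rfl fun k _ => by ring

theorem norm_natCast_lt_one {y : ℕ} (hy : p ∣ y) : ‖(y : ℂ_[p])‖ < 1 := by
  rw [← map_natCast (algebraMap ℚ_[p] ℂ_[p]), norm_algebraMap_padic]
  exact norm_lt_one_of_dvd p hy

theorem norm_choose_mul_le (z : ℤ) (n : ℕ) (x c : ℂ_[p]) {C : ℝ} (hc : ‖c‖ ≤ C) :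
    ‖((Ring.choose z n : ℤ) : ℂ_[p]) * x ^ n * c‖ ≤ C * ‖x‖ ^ n := by
  have hchoose : ‖((Ring.choose z n : ℤ) : ℂ_[p])‖ ≤ 1 := by
    rw [← map_intCast (algebraMap ℚ_[p] ℂ_[p]), norm_algebraMap_padic]
    exact norm_intCast_le_one _
  rw [norm_mul, norm_mul, norm_pow, mul_comm]
  exact mul_le_mul hc (mul_le_of_le_one_left (by positivity) hchoose) (by positivity)
    ((norm_nonneg c).trans hc)

theorem summable_geometric_bound {ρ : ℝ} (h0 : 0 ≤ ρ) (h1 : ρ < 1) (c C b : ℝ) (m : ℕ) :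
    Summable fun n : ℕ => (if n = 0 then c else C * (((m + n : ℕ) : ℝ) * b)) * ρ ^ n := by
  rw [← summable_nat_add_iff 1]
  have h2 := (summable_natCast_mul_geometric h0 h1).mul_left (C * b * ρ)
  have h3 := (summable_geometric_of_lt_one h0 h1).mul_left (C * m * b * ρ)
  refine (h2.add h3).congr fun n => ?_
  rw [if_neg (Nat.succ_ne_zero n), pow_succ]
  push_cast
  ring

/-- The Taylor expansion of `phi` may be averaged term by term. -/
theorem hasMean_phi_add {m y D : ℕ} (hm : 1 ≤ m) (hy : p ∣ y) (hD0 : 0 < D) (hD : p ∣ D)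
    {w : ℕ → ℂ_[p]} (hw : ∀ a t, w (a + D * t) = w a) (hw1 : ∀ a, ‖w a‖ ≤ 1) {G : ℕ → ℂ_[p]}
    (hG : ∀ n, HasMean (fun k => w k * algebraMap ℚ_[p] ℂ_[p] (phi p (m + n) k)) (G n)) :
    HasMean (fun k => w k * algebraMap ℚ_[p] ℂ_[p] (phi p m (k + y)))
      (∑' n : ℕ, ((Ring.choose (-(m : ℤ)) n : ℤ) : ℂ_[p]) * (y : ℂ_[p]) ^ n * G n) := by
  have h3 : ∀ᶠ X : ℕ in toZero, ‖(X : ℂ_[p])⁻¹ * ∑ k ∈ Icc 1 X, w k *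
      algebraMap ℚ_[p] ℂ_[p] (phi p (m + 0) k)‖ ≤ ‖G 0‖ + 1 :=
    (hG 0).norm.eventually_le_const (by linarith)
  -- the term `n = 0` is bounded because it converges, the others are bounded uniformly
  have h2 : ∀ᶠ X : ℕ in toZero, ∀ n, ‖((Ring.choose (-(m : ℤ)) n : ℤ) : ℂ_[p]) * (y : ℂ_[p]) ^ n *
      ((X : ℂ_[p])⁻¹ * ∑ k ∈ Icc 1 X, w k * algebraMap ℚ_[p] ℂ_[p] (phi p (m + n) k))‖ ≤
      (if n = 0 then ‖G 0‖ + 1 else ‖(D : ℂ_[p])⁻¹‖ * (((m + n : ℕ) : ℝ) * p)) *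
        ‖(y : ℂ_[p])‖ ^ n := by
    filter_upwards [h3, eventually_toZero_dvd hD0] with X hX ⟨_, hDX⟩ n
    refine norm_choose_mul_le _ _ _ _ ?_
    rcases Nat.eq_zero_or_pos n with rfl | hn
    · rw [if_pos rfl]
      exact hX
    · rw [if_neg hn.ne']
      exact norm_sum_phi_le hD (by lia) hDX hw hw1
  have h4 := tendsto_tsum_of_dominated_convergence
    (summable_geometric_bound (norm_nonneg _) (norm_natCast_lt_one hy) _ _ _ m)
    (fun n => Tendsto.const_mul _ (hG n)) h2
  exact Tendsto.congr (fun X => (hasSum_mean_phi_add hm hy w X).tsum_eq) h4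

/-- The `k` with `k + y` divisible by `r` are given by `k + y = r * (l + y / r)`, `l ≥ 1`, because
the least positive one is `r - y % r`. -/
theorem hasMean_multiples {g : ℕ → ℂ_[p]} {B : ℂ_[p]} {r y : ℕ} (hr : 0 < r)
    (hB : HasMean (fun l => g (r * (l + y / r))) B) :
    HasMean (fun k => (if r ∣ k + y then 1 else 0) * g (k + y)) ((r : ℂ_[p])⁻¹ * B) := by
  have hc : y % r < r := Nat.mod_lt y hr
  have hy := Nat.div_add_mod y r
  have h := HasMean.of_classes (g := fun k => (if r ∣ k + y then 1 else 0) * g (k + y)) hr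
    (Z := fun a => if a = r - y % r then B else 0) fun a ha => by
    rw [mem_Icc] at ha
    by_cases ha0 : a = r - y % r
    · rw [if_pos ha0]
      refine Tendsto.congr (fun X => ?_) hB
      rw [sum_Icc_one]
      congr 1
      refine sum_congr rfl fun t _ => ?_
      have h1 : a + r * t + y = r * (t + 1 + y / r) := by
        have : a + y % r = r := by lia
        nlinarith
      rw [h1, if_pos (dvd_mul_right _ _), one_mul]
    · rw [if_neg ha0]
      refine Tendsto.congr (fun X => ?_) tendsto_const_nhds
      rw [sum_eq_zero, mul_zero]
      intro t _
      rw [if_neg, zero_mul]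
      intro hd
      have h1 : a + r * t + y = (a + y % r) + r * (t + y / r) := by nlinarith
      rw [h1, Nat.dvd_add_left (dvd_mul_right _ _)] at hd
      obtain ⟨e, he⟩ := hd
      have h2 : e < 2 := by
        by_contra! h3
        have := Nat.mul_le_mul_left r h3
        lia
      interval_cases e <;> lia
  have h0 : r - y % r ∈ Icc 1 r := mem_Icc.2 ⟨by lia, Nat.sub_le _ _⟩
  rwa [sum_ite_eq' _ _ (fun _ => B), if_pos h0] at h

/-- The average of `phi m (k + y)` over the `k` with `k + y` divisible by `r`. -/
theorem hasMean_residue {m r y : ℕ} (hm : 1 ≤ m) (hr : 0 < r) (hrp : ¬ p ∣ r) {A : ℂ_[p]}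
    (hA : HasMean (fun k => algebraMap ℚ_[p] ℂ_[p] (phi p m k)) A) :
    HasMean (fun k => (if r ∣ k + y then 1 else 0) * algebraMap ℚ_[p] ℂ_[p] (phi p m (k + y)))
      ((r : ℂ_[p])⁻¹ * ((r : ℂ_[p]) ^ (1 - (m : ℤ)) *
        (A - ∑ l ∈ Icc 1 (y / r) with l.Coprime p, 1 / (l : ℂ_[p]) ^ m) +
          algebraMap ℚ_[p] ℂ_[p] (phiDefect p m r) * (1 - 1 / (p : ℂ_[p])))) := by
  have hB := ((hasMean_phi_shift hm hA (y / r)).const_mul ((r : ℂ_[p]) ^ (1 - (m : ℤ)))).add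
    ((hasMean_unit_shift (y / r)).const_mul (algebraMap ℚ_[p] ℂ_[p] (phiDefect p m r)))
  exact hasMean_multiples (g := fun k => algebraMap ℚ_[p] ℂ_[p] (phi p m k)) hr
    (hB.congr fun k => (phi_mul_algebraMap hrp _).symm)

/-! ### The expansion -/

/-- Convergence of the expansion: the averages grow at most linearly in `n`, and `‖y‖ < 1`. -/
theorem summable_taylor {m y D : ℕ} (hm : 1 ≤ m) (hy : p ∣ y) (hD0 : 0 < D) (hD : p ∣ D)
    {w : ℕ → ℂ_[p]} (hw : ∀ a t, w (a + D * t) = w a) (hw1 : ∀ a, ‖w a‖ ≤ 1) {G : ℕ → ℂ_[p]}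
    (hG : ∀ n, 1 ≤ n →
      HasMean (fun k => w k * algebraMap ℚ_[p] ℂ_[p] (phi p (m + n) k)) (G n)) :
    Summable fun n : ℕ => ((Ring.choose (-(m : ℤ)) n : ℤ) : ℂ_[p]) * (y : ℂ_[p]) ^ n * G n := by
  refine Summable.of_norm_bounded (summable_geometric_bound (norm_nonneg _)
    (norm_natCast_lt_one hy) ‖G 0‖ ‖(D : ℂ_[p])⁻¹‖ p m) fun n => norm_choose_mul_le _ _ _ _ ?_
  rcases Nat.eq_zero_or_pos n with rfl | hn
  · rw [if_pos rfl]
  · rw [if_neg hn.ne']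
    exact (hG n hn).norm_phi_le hD0 hD (by lia) hw hw1

section

variable {d r : ℕ}

theorem not_dvd_of_coprime_mul (hrdp : r.Coprime (d * p)) {q : ℕ} (hq : q ∣ r) : ¬ p ∣ q :=
  fun h => (Fact.out : p.Prime).one_lt.ne'
    (Nat.eq_one_of_dvd_coprimes hrdp (h.trans hq) (dvd_mul_left p d))

theorem primeFactors_div_spec (hrdp : r.Coprime (d * p)) {f : ℕ} (hf : f ∣ r) :
    ∀ q ∈ (r / f).primeFactors, q.Prime ∧ ¬ p ∣ q := fun _ hq =>
  ⟨Nat.prime_of_mem_primeFactors hq, not_dvd_of_coprime_mul hrdp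
    ((Nat.dvd_of_mem_primeFactors hq).trans (Nat.div_dvd_of_dvd hf))⟩

theorem sifted_periodic (hr : 0 < r) {f : ℕ} (hf : f ∣ r) (ψ : DirichletCharacter ℂ_[p] f)
    (a t : ℕ) :
    sifted ψ (r / f).primeFactors (a + r * p * t) = sifted ψ (r / f).primeFactors a := by
  rw [sifted_eq_changeLevel hr hf, sifted_eq_changeLevel hr hf, periodic_char (dvd_mul_right r p)]

theorem norm_sifted_le {f : ℕ} (ψ : DirichletCharacter ℂ_[p] f) (T : Finset ℕ) (a : ℕ) :
    ‖sifted ψ T a‖ ≤ 1 := by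
  rw [sifted]
  split_ifs
  · simp
  · exact DirichletCharacter.norm_le_one ψ _

theorem hasMean_eulerCorrection_mul_LValue (hr : 0 < r) (hrdp : r.Coprime (d * p)) {f : ℕ}
    (hf : f ∣ r) {ψ : DirichletCharacter ℂ_[p] f} (hψ : ψ.IsPrimitive) {s : ℕ} (hs : 1 ≤ s)
    (hψs : s = 1 → ψ ≠ 1) :
    HasMean (fun k => sifted ψ (r / f).primeFactors k * algebraMap ℚ_[p] ℂ_[p] (phi p s k))
      (eulerCorrection p ψ r (-(s : ℤ)) * LValue p ψ s) := by
  have hf0 := Nat.pos_of_dvd_of_pos hf hr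
  exact hasMean_sifted_phi hf0 hψs (hasMean_LValue hf0
    (coprime_iff_not_dvd.2 (not_dvd_of_coprime_mul hrdp hf)) hψ hs hψs) _
    (primeFactors_div_spec hrdp hf)

theorem expansionTerm_eq (m : ℕ) {f : ℕ} (ψ : DirichletCharacter ℂ_[p] f) (n : ℕ) :
    expansionTerm p d r m ψ n = ((Ring.choose (-(m : ℤ)) n : ℤ) : ℂ_[p]) *
      ((d * p : ℕ) : ℂ_[p]) ^ n *
        (eulerCorrection p ψ r (-((m + n : ℕ) : ℤ)) * LValue p ψ (m + n)) := by
  rw [expansionTerm, show (-((m + n : ℕ) : ℤ)) = -(m : ℤ) - n by push_cast; ring]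
  ring

theorem summable_expansionTerm (hr : 0 < r) (hrdp : r.Coprime (d * p)) {m : ℕ} (hm : 1 ≤ m)
    {f : ℕ} (hf : f ∣ r) {ψ : DirichletCharacter ℂ_[p] f} (hψ : ψ.IsPrimitive) :
    Summable (expansionTerm p d r m ψ) := by
  simp_rw [funext (expansionTerm_eq m ψ)]
  exact summable_taylor hm (dvd_mul_left p d) (Nat.mul_pos hr (Fact.out : p.Prime).pos)
    (dvd_mul_left p r) (sifted_periodic hr hf ψ) (norm_sifted_le ψ _) fun n hn =>
      hasMean_eulerCorrection_mul_LValue hr hrdp hf hψ (by lia) (by lia)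

variable (p) in
/-- The indicator function of the residue class of `-y` modulo `r`. -/
noncomputable def classIndicator (r y k : ℕ) : ℂ_[p] := if r ∣ k + y then 1 else 0

theorem classIndicator_periodic (r y a t : ℕ) :
    classIndicator p r y (a + r * p * t) = classIndicator p r y a := by
  have h : r ∣ a + r * p * t + y ↔ r ∣ a + y := by
    rw [add_right_comm]
    exact Nat.dvd_add_left ((dvd_mul_right r p).mul_right t)
  simp only [classIndicator, h]

theorem norm_classIndicator_le (r y k : ℕ) : ‖classIndicator p r y k‖ ≤ 1 := by
  rw [classIndicator]; split_ifs <;> simp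

theorem exists_hasMean_class (hr : 0 < r) (y : ℕ) {s : ℕ} (hs : 1 ≤ s) :
    ∃ G, HasMean (fun k => classIndicator p r y k * algebraMap ℚ_[p] ℂ_[p] (phi p s k)) G :=
  ⟨_, hasMean_phi (Nat.mul_pos hr (Fact.out : p.Prime).pos) (dvd_mul_left p r) hs
    (classIndicator_periodic r y)⟩

/-- The character sums in the expansion are averages over the residue class of `-d p`. -/
theorem sum_primitiveChars_mul_eq (hr : 0 < r) (hrdp : r.Coprime (d * p)) {s : ℕ}
    {V : ∀ f : ℕ, DirichletCharacter ℂ_[p] f → ℂ_[p]} {G : ℂ_[p]}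
    (hV : ∀ f ∈ r.divisors, ∀ ψ ∈ primitiveChars p f,
      HasMean (fun k => sifted ψ (r / f).primeFactors k * algebraMap ℚ_[p] ℂ_[p] (phi p s k))
        (V f ψ))
    (hG : HasMean (fun k => classIndicator p r (d * p) k *
      algebraMap ℚ_[p] ℂ_[p] (phi p s k)) G) :
    ∑ f ∈ r.divisors, ∑ ψ ∈ primitiveChars p f, ψ⁻¹ (-((d * p : ℕ) : ZMod f)) * V f ψ =
      (r.totient : ℂ_[p]) * G := by
  have h1 := HasMean.sum fun f hf => HasMean.sum fun ψ hψ =>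
    (hV f hf ψ hψ).const_mul (ψ⁻¹ (-((d * p : ℕ) : ZMod f)))
  refine h1.unique ((hG.const_mul _).congr fun k => ?_)
  have hb : IsCoprime (-((d * p : ℕ) : ℤ)) (r : ℤ) := by
    rw [IsCoprime.neg_left_iff, Nat.isCoprime_iff_coprime]
    exact hrdp.symm
  have h2 := sum_primitiveChars_mul_sifted (p := p) hr hb k
  simp only [Int.cast_neg, Int.cast_natCast] at h2
  have h3 : (-((d * p : ℕ) : ZMod r) = k) ↔ r ∣ k + d * p := by
    rw [← ZMod.natCast_eq_zero_iff, Nat.cast_add, neg_eq_iff_add_eq_zero, add_comm]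
  simp_rw [← mul_assoc, ← sum_mul]
  rw [h2, classIndicator]
  simp only [h3, mul_ite, mul_one, mul_zero]

theorem sum_primitiveChars_expansionTerm (hr : 0 < r) (hrdp : r.Coprime (d * p)) {m n : ℕ}
    (hmn : 2 ≤ m + n) {G : ℂ_[p]}
    (hG : HasMean (fun k => classIndicator p r (d * p) k *
      algebraMap ℚ_[p] ℂ_[p] (phi p (m + n) k)) G) :
    ∑ f ∈ r.divisors, ∑ ψ ∈ primitiveChars p f,
      ψ⁻¹ (-((d * p : ℕ) : ZMod f)) * expansionTerm p d r m ψ n =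
        (r.totient : ℂ_[p]) * (((Ring.choose (-(m : ℤ)) n : ℤ) : ℂ_[p]) *
          ((d * p : ℕ) : ℂ_[p]) ^ n * G) := by
  have h := sum_primitiveChars_mul_eq (V := fun f ψ =>
    eulerCorrection p ψ r (-((m + n : ℕ) : ℤ)) * LValue p ψ (m + n)) hr hrdp
    (fun f hf ψ hψ => hasMean_eulerCorrection_mul_LValue hr hrdp (Nat.dvd_of_mem_divisors hf)
      (mem_primitiveChars.1 hψ) (by lia) (by lia)) hG
  rw [mul_left_comm, ← h, mul_sum]
  simp_rw [mul_sum, expansionTerm_eq]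
  exact sum_congr rfl fun f _ => sum_congr rfl fun ψ _ => by ring

/-- The averages over the residue class of `-d p` modulo `r` add up to the average of
`phi m (k + d p)` over the `k` with `r ∣ k + d p`, which contains the sum `lehmerSum p d r m`. -/
theorem tsum_classMeans (hr : 0 < r) (hrdp : r.Coprime (d * p)) {m : ℕ} (hm : 1 ≤ m) {A : ℂ_[p]}
    (hA : HasMean (fun k => algebraMap ℚ_[p] ℂ_[p] (phi p m k)) A) {G : ℕ → ℂ_[p]}
    (hG : ∀ n, HasMean (fun k => classIndicator p r (d * p) k *
      algebraMap ℚ_[p] ℂ_[p] (phi p (m + n) k)) (G n)) :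
    ∑' n : ℕ, ((Ring.choose (-(m : ℤ)) n : ℤ) : ℂ_[p]) * ((d * p : ℕ) : ℂ_[p]) ^ n * G n =
      (r : ℂ_[p])⁻¹ * ((r : ℂ_[p]) ^ (1 - (m : ℤ)) * (A - lehmerSum p d r m) +
        algebraMap ℚ_[p] ℂ_[p] (phiDefect p m r) * (1 - 1 / (p : ℂ_[p]))) :=
  (hasMean_phi_add hm (dvd_mul_left p d) (Nat.mul_pos hr (Fact.out : p.Prime).pos)
    (dvd_mul_left p r) (classIndicator_periodic r _) (norm_classIndicator_le r _) hG).unique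
    (hasMean_residue hm hr (not_dvd_of_coprime_mul hrdp dvd_rfl) hA)

/-- The expansion for exponents `m > 1`. -/
theorem lehmerSum_eq_of_one_lt (hr : 0 < r) (hrdp : r.Coprime (d * p)) {m : ℕ} (hm : 1 < m) :
    lehmerSum p d r m = LValue p (1 : DirichletCharacter ℂ_[p] 1) m -
      (r : ℂ_[p]) ^ m / (r.totient : ℂ_[p]) * ∑ f ∈ r.divisors, ∑ ψ ∈ primitiveChars p f,
        ψ⁻¹ (-((d * p : ℕ) : ZMod f)) * ∑' n : ℕ, expansionTerm p d r m ψ n := by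
  have hA : HasMean (fun k => algebraMap ℚ_[p] ℂ_[p] (phi p m k))
      (LValue p (1 : DirichletCharacter ℂ_[p] 1) m) :=
    (hasMean_LValue one_pos (Nat.coprime_one_left p)
      DirichletCharacter.isPrimitive_one_level_one hm.le (by lia)).congr fun k => by
        rw [MulChar.one_apply (isUnit_of_subsingleton _), one_mul]
  choose G hG using fun n : ℕ => exists_hasMean_class (p := p) hr (d * p) (s := m + n) (by lia)
  have h1 : ∑ f ∈ r.divisors, ∑ ψ ∈ primitiveChars p f,
      ψ⁻¹ (-((d * p : ℕ) : ZMod f)) * ∑' n : ℕ, expansionTerm p d r m ψ n =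
      ∑' n : ℕ, (r.totient : ℂ_[p]) * (((Ring.choose (-(m : ℤ)) n : ℤ) : ℂ_[p]) *
          ((d * p : ℕ) : ℂ_[p]) ^ n * G n) := by
    have hs : ∀ f ∈ r.divisors, ∀ ψ ∈ primitiveChars p f, Summable fun n =>
        ψ⁻¹ (-((d * p : ℕ) : ZMod f)) * expansionTerm p d r m ψ n := fun f hf ψ hψ =>
      (summable_expansionTerm hr hrdp hm.le (Nat.dvd_of_mem_divisors hf)
        (mem_primitiveChars.1 hψ)).mul_left _
    simp_rw [← fun n => sum_primitiveChars_expansionTerm hr hrdp (by lia) (hG n)]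
    rw [Summable.tsum_finsetSum fun f hf => summable_sum (hs f hf)]
    refine sum_congr rfl fun f hf => ?_
    rw [Summable.tsum_finsetSum (hs f hf)]
    exact sum_congr rfl fun ψ _ => tsum_mul_left.symm
  have hr0 : (r : ℂ_[p]) ≠ 0 := by exact_mod_cast hr.ne'
  have ht0 : (r.totient : ℂ_[p]) ≠ 0 := by exact_mod_cast (Nat.totient_pos.2 hr).ne'
  rw [h1, tsum_mul_left, tsum_classMeans hr hrdp hm.le hA hG, phiDefect, if_neg hm.ne',
    sub_eq_add_neg 1 (m : ℤ), zpow_add₀ hr0, zpow_one, zpow_neg, zpow_natCast]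
  simp only [map_zero, zero_mul, add_zero]
  field_simp
  ring

theorem totient_eq_mul_prod (r : ℕ) :
    (r.totient : ℂ_[p]) = r * ∏ q ∈ r.primeFactors, (1 - 1 / (q : ℂ_[p])) := by
  have h := congrArg (Rat.cast : ℚ → ℂ_[p]) (Nat.totient_eq_mul_prod_factors r)
  push_cast at h
  simpa only [one_div] using h

theorem padicLog_pow_eq (q : ℕ) :
    padicLog p ((q : ℚ_[p]) ^ (p - 1)) = ((p : ℚ_[p]) - 1) * logUnit p q := by
  rw [logUnit, mul_div_cancel₀ _ p_sub_one_ne_zero]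

open Classical in
/-- The expansion for the exponent `1`. -/
theorem lehmerSum_one_eq (hr : 0 < r) (hrdp : r.Coprime (d * p)) :
    lehmerSum p d r 1 =
        -(1 / (p : ℂ_[p])) * algebraMap ℚ_[p] ℂ_[p]
            (padicLog p ((r : ℚ_[p]) ^ (p - 1)) +
              ∑ q ∈ r.primeFactors, padicLog p ((q : ℚ_[p]) ^ (p - 1)) / ((q : ℚ_[p]) - 1)) -
          (r : ℂ_[p]) / (r.totient : ℂ_[p]) *
            ∑' n : ℕ, ∑ f ∈ r.divisors,
              ∑ ψ ∈ primitiveChars p f with ¬(ψ = 1 ∧ n = 0),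
                ψ⁻¹ (-((d * p : ℕ) : ZMod f)) * expansionTerm p d r 1 ψ n := by
  have hp0 : (p : ℂ_[p]) ≠ 0 := by exact_mod_cast (Fact.out : p.Prime).ne_zero
  have hr0 : (r : ℂ_[p]) ≠ 0 := by exact_mod_cast hr.ne'
  have ht0 : (r.totient : ℂ_[p]) ≠ 0 := by exact_mod_cast (Nat.totient_pos.2 hr).ne'
  obtain ⟨A, hA'⟩ := exists_hasMean_class (p := p) one_pos 0 (s := 1) le_rfl
  have hA : HasMean (fun k => algebraMap ℚ_[p] ℂ_[p] (phi p 1 k)) A :=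
    hA'.congr fun k => by simp [classIndicator]
  choose G hG using fun n : ℕ => exists_hasMean_class (p := p) hr (d * p) (s := 1 + n) (by lia)
  set T : ℕ → ℂ_[p] := fun n => ((Ring.choose (-((1 : ℕ) : ℤ)) n : ℤ) : ℂ_[p]) *
    ((d * p : ℕ) : ℂ_[p]) ^ n * G n with hT
  have hTs : Summable T := summable_taylor le_rfl (dvd_mul_left p d)
    (Nat.mul_pos hr (Fact.out : p.Prime).pos) (dvd_mul_left p r) (classIndicator_periodic r _)
    (norm_classIndicator_le r _) fun n _ => hG n
  have hTt := tsum_classMeans hr hrdp le_rfl hA hG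
  -- the trivial character contributes to the averages at `n = 0`, but not to the expansion
  set P : ℂ_[p] := ∏ q ∈ r.primeFactors, (1 - 1 / (q : ℂ_[p])) with hP
  set Λ : ℂ_[p] := ∑ q ∈ r.primeFactors,
    algebraMap ℚ_[p] ℂ_[p] (logUnit p q) / ((q : ℂ_[p]) - 1) with hΛ
  have hn : ∀ n : ℕ, ∑ f ∈ r.divisors, ∑ ψ ∈ primitiveChars p f with ¬(ψ = 1 ∧ n = 0),
      ψ⁻¹ (-((d * p : ℕ) : ZMod f)) * expansionTerm p d r 1 ψ n =
      (r.totient : ℂ_[p]) * T n -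
        (if n = 0 then P * (A + (1 - 1 / (p : ℂ_[p])) * Λ) else 0) := by
    intro n
    rcases Nat.eq_zero_or_pos n with rfl | hn
    · set V0 := P * (A + (1 - 1 / (p : ℂ_[p])) * Λ) with hV0
      have h1 := sum_primitiveChars_mul_eq (s := 1) (V := fun f ψ => if ψ = 1 then V0 else
        eulerCorrection p ψ r (-((1 : ℕ) : ℤ)) * LValue p ψ 1) hr hrdp
        (fun f hf ψ hψ => by
          have hfr := Nat.dvd_of_mem_divisors hf
          have hprim := mem_primitiveChars.1 hψ
          have : NeZero f := ⟨(Nat.pos_of_dvd_of_pos hfr hr).ne'⟩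
          by_cases hψ1 : ψ = 1
          · have hf1 : f = 1 := by
              rw [← show ψ.conductor = f from hprim, hψ1, DirichletCharacter.conductor_one]
            subst hf1
            subst hψ1
            rw [if_pos rfl, Nat.div_one]
            have := hasMean_sifted_one_phi_one hA r.primeFactors fun q hq =>
              ⟨Nat.prime_of_mem_primeFactors hq,
                not_dvd_of_coprime_mul hrdp (Nat.dvd_of_mem_primeFactors hq)⟩
            exact this
          · rw [if_neg hψ1]
            exact hasMean_eulerCorrection_mul_LValue hr hrdp hfr hprim le_rfl fun _ => hψ1) (hG 0)
      have h2 : ∑ f ∈ r.divisors, ∑ ψ ∈ primitiveChars p f,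
          (if ψ = 1 then ψ⁻¹ (-((d * p : ℕ) : ZMod f)) * V0 else 0) = V0 := by
        rw [sum_eq_single_of_mem 1 (Nat.one_mem_divisors.2 hr.ne')]
        · refine (sum_eq_single_of_mem (1 : DirichletCharacter ℂ_[p] 1) (mem_primitiveChars.2
            DirichletCharacter.isPrimitive_one_level_one) fun ψ _ h => if_neg h).trans ?_
          rw [if_pos rfl, inv_one, MulChar.one_apply (isUnit_of_subsingleton _), one_mul]
        · intro f hf hf1
          refine sum_eq_zero fun ψ hψ => if_neg fun hψ1 => hf1 ?_
          have : NeZero f :=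
            ⟨(Nat.pos_of_dvd_of_pos (Nat.dvd_of_mem_divisors hf) hr).ne'⟩
          rw [← show ψ.conductor = f from mem_primitiveChars.1 hψ, hψ1,
            DirichletCharacter.conductor_one]
      have h3 : (r.totient : ℂ_[p]) * T 0 = (r.totient : ℂ_[p]) * G 0 := by
        simp only [hT, Ring.choose_zero_right, Int.cast_one, pow_zero, one_mul]
      rw [if_pos rfl, h3, ← h1, eq_sub_iff_add_eq]
      refine (congrArg (_ + ·) h2.symm).trans ?_
      rw [← sum_add_distrib]
      refine sum_congr rfl fun f _ => ?_
      rw [sum_filter, ← sum_add_distrib]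
      refine sum_congr rfl fun ψ _ => ?_
      by_cases hψ1 : ψ = 1
      · simp [hψ1]
      · simp [hψ1, expansionTerm_eq]
    · rw [if_neg hn.ne', sub_zero, ← sum_primitiveChars_expansionTerm hr hrdp (by lia) (hG n)]
      simp [hn.ne']
  have htsum : ∑' n : ℕ, ∑ f ∈ r.divisors, ∑ ψ ∈ primitiveChars p f with ¬(ψ = 1 ∧ n = 0),
      ψ⁻¹ (-((d * p : ℕ) : ZMod f)) * expansionTerm p d r 1 ψ n =
      (r.totient : ℂ_[p]) * ∑' n, T n - P * (A + (1 - 1 / (p : ℂ_[p])) * Λ) := by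
    rw [tsum_congr hn]
    refine ((hTs.hasSum.mul_left _).sub ?_).tsum_eq
    exact hasSum_ite_eq 0 _
  have htot : (r.totient : ℂ_[p]) = r * P := totient_eq_mul_prod r
  have hP0 : P ≠ 0 := fun h => ht0 (by rw [htot, h, mul_zero])
  have hlog : algebraMap ℚ_[p] ℂ_[p] (padicLog p ((r : ℚ_[p]) ^ (p - 1)) +
      ∑ q ∈ r.primeFactors, padicLog p ((q : ℚ_[p]) ^ (p - 1)) / ((q : ℚ_[p]) - 1)) =
      ((p : ℂ_[p]) - 1) * (algebraMap ℚ_[p] ℂ_[p] (logUnit p r) + Λ) := by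
    rw [hΛ, map_add, map_sum, mul_add, mul_sum, padicLog_pow_eq, map_mul, map_sub, map_natCast,
      map_one]
    congr 1
    refine sum_congr rfl fun q _ => ?_
    rw [padicLog_pow_eq, map_div₀, map_mul, map_sub, map_sub, map_natCast, map_natCast, map_one,
      mul_div_assoc]
  rw [htsum, hlog, hTt, htot, phiDefect, if_pos rfl, Nat.cast_one, sub_self, zpow_zero, map_neg]
  field_simp
  ring

end

end Lehmer

open Classical Lehmer in
theorem mainTheorem1 (p : ℕ) [Fact p.Prime] (hp : p ≠ 2) (d r : ℕ) (hd : 0 < d) (hr : 0 < r)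
    (hrdp : r.Coprime (d * p)) :
    ((∀ f ∈ r.divisors, ∀ ψ ∈ primitiveChars p f, Summable (expansionTerm p d r 1 ψ)) ∧
      lehmerSum p d r 1 =
        -(1 / (p : ℂ_[p])) * algebraMap ℚ_[p] ℂ_[p]
            (padicLog p ((r : ℚ_[p]) ^ (p - 1)) +
              ∑ q ∈ r.primeFactors, padicLog p ((q : ℚ_[p]) ^ (p - 1)) / ((q : ℚ_[p]) - 1)) -
          (r : ℂ_[p]) / (r.totient : ℂ_[p]) *
            ∑' n : ℕ, ∑ f ∈ r.divisors,
              ∑ ψ ∈ primitiveChars p f with ¬(ψ = 1 ∧ n = 0),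
                ψ⁻¹ (-((d * p : ℕ) : ZMod f)) * expansionTerm p d r 1 ψ n) ∧
    (∀ m : ℕ, 1 < m →
      (∀ f ∈ r.divisors, ∀ ψ ∈ primitiveChars p f, Summable (expansionTerm p d r m ψ)) ∧
      lehmerSum p d r m =
        LValue p (1 : DirichletCharacter ℂ_[p] 1) m -
          (r : ℂ_[p]) ^ m / (r.totient : ℂ_[p]) *
            ∑ f ∈ r.divisors, ∑ ψ ∈ primitiveChars p f,
              ψ⁻¹ (-((d * p : ℕ) : ZMod f)) * ∑' n : ℕ, expansionTerm p d r m ψ n) := by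
  have hsum : ∀ m : ℕ, 1 ≤ m → ∀ f ∈ r.divisors, ∀ ψ ∈ primitiveChars p f,
      Summable (expansionTerm p d r m ψ) := fun m hm f hf ψ hψ =>
    summable_expansionTerm hr hrdp hm (Nat.dvd_of_mem_divisors hf) (mem_primitiveChars.1 hψ)
  exact ⟨⟨hsum 1 le_rfl, lehmerSum_one_eq hr hrdp⟩,
    fun m hm => ⟨hsum m hm.le, lehmerSum_eq_of_one_lt hr hrdp hm⟩⟩
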